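/- **Setting.** There are $N$ agents, connected by authenticated, reliable, asynchronous channels. At most $t<N/3$ of them are Byzantine (arbitrary behaviour, but only under their own name). The remaining agents are *rational*, and it is assumed that no rational agent deviates from the Hearsay protocol. A transaction $tx$ consists of an initiator, a recipient, a value $x\ge 0$, a sequence number, and two finite sets of earlier transactions: $tx.\mathrm{deps}$ (incoming payments) and $tx.\mathrm{fees}$ (transactions whose fee is converted). Every agent keeps, for each agent $i$, a local view of its balance $B[i]$ (initially a commonly known number larger than $N\epsilon$, where $\epsilon\ge 0$ is the fee), of the sequence number $S[i]$ of its last executed transaction (initially $0$), of the set $Q[i]$ of payments to $i$ not yet credited, and of the set $F[i]$ of fee credits of $i$ not yet converted (both initially empty). *Pay.* Agent $p$ may broadcast a transaction of value $x$ with the next sequence number ($1,2,\dots$) if $B[p]\ge x+N\epsilon$ in its own view. It puts into $\mathrm{deps}$ the payments in $Q[p]$, and into $\mathrm{fees}$ either nothing or the fee credits in $F[p]$, that its earlier transactions did not refer to. *Broadcast.* Transactions are sent by Rational Reliable Broadcast, with one instance per initiator: the initiator sends $tx$ in an initial message to all agents; an agent echoes the first $tx$ it gets in an initial message for a sequence number;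 on more than $(N+t)/2$ echo messages or at least $t+1$ ready messages for $tx$, an agent sends echo and ready messages for $tx$, each kind at most once per sequence number; it delivers $tx$ on at least $2t+1$ ready messages, at most one transaction per sequence number. Messages from an agent are processed in the order of sequence numbers, duplicates are ignored, and echo and ready messages for a sequence number are sent to an agent only after its echo and ready messages for all lower sequence numbers of the instance have arrived (retaliation). *Execute.* An agent executes a delivered $tx$ with initiator $a$ once (1) $S[a]=tx.\mathrm{seq}-1$, (2) it has executed all transactions in $tx.\mathrm{deps}\cup tx.\mathrm{fees}$, and (3) $B[a]\ge N\epsilon$ or $|tx.\mathrm{fees}\cap F[a]|\ge N$. It credits the payments in $tx.\mathrm{deps}\cap Q[a]$ and $\epsilon$ for every element of $tx.\mathrm{fees}\cap F[a]$ to $B[a]$, and removes them from $Q[a]$ and $F[a]$. Call the resulting $B[a]$ the *available balance*. The transaction is *bad* if the available balance is less than $x+N\epsilon$ or some element of $tx.\mathrm{deps}$ is bad. If it is not bad, it is *committed*: $x$ is subtracted from $B[a]$ and $tx$ is added to $Q[\text{recipient}]$. In any case $N\epsilon$ is subtracted from $B[a]$, $tx$ is added to $F[j]$ for every $j$, and $S[a]$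 grows by one. **Statement.** In every execution of the system: 1. If a rational agent $p$ broadcasts $tx$, and its balance $B[p]$ in its own view covers at that moment the values and fees of $tx$ and of all transactions that $p$ has broadcast before but not yet executed (by the check in Pay this is automatic if $p$ has executed all its earlier transactions), then every rational agent eventually executes $tx$. 2. No agent, rational or Byzantine, can spend money it lacks, go into debt or double-spend. That is: * In the view of every rational agent, all balances are non-negative at all times. * When a rational agent executes $tx$, the available balance is at least $N\epsilon$, and when it commits $tx$, the available balance is at least $x+N\epsilon$. If one rational agent executes $tx$ without committing it, then no rational agent ever commits $tx$. If a rational agent executes a transaction with a rational initiator, then the initiator has broadcast it before. * If two (equal or different) rational agents execute transactions with the same initiator and the same sequence number, these transactions are equal. No rational agent executes a transaction twice. No payment is credited by two different transactions, and no fee credit of an agent is converted by two different transactions of this agent, not even when the executions are those of two different rational agents. * In the view of every rational agent, at all times and for every agent $i$, $$B[i]+\sum_{u\in Q[i]}u.\mathrm{value}+\epsilon|F[i]| = B_0[i]+\sum_{u\text{ committed, recipient }i}u.\mathrm{value}+\epsilon\,|\{u\text{ executed}\}|-\sum_{u\text{ committed, initiator }i}u.\mathrm{value}-N\epsilon\,|\{u\text{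 executed, initiator }i\}|,$$ where $B_0[i]$ is the initial balance and every transaction counts once. -/

import Mathlib

open scoped NNReal

namespace Hearsay

/-- A transaction. `deps` and `fees` enumerate the finite sets of incoming payments and of
fee-paying transactions it refers to; order and multiplicity are never used. -/
structure Tx (N : ℕ) : Type where
  initiator : Fin N
  recipient : Fin N
  value : ℝ≥0
  seq : ℕ
  deps : List (Tx N)
  fees : List (Tx N)

noncomputable instance (N : ℕ) : DecidableEq (Tx N) := Classical.decEq _

variable {N : ℕ}

/-- Two transactions compete for the same slot of the same broadcast channel. -/
def SameSlot (u v : Tx N) : Prop := u.initiator = v.initiator ∧ u.seq = v.seq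

/-- No transaction in `A` occupies the slot of `tx`. -/
def SlotFree (A : Set (Tx N)) (tx : Tx N) : Prop := ∀ u ∈ A, ¬ SameSlot u tx

open scoped Classical in
/-- Add `tx` to `A`, unless its slot is already taken (duplicates are ignored). -/
noncomputable def file (A : Set (Tx N)) (tx : Tx N) : Set (Tx N) :=
  if SlotFree A tx then insert tx A else A

/-- The three kinds of messages of Rational Reliable Broadcast. -/
inductive Kind : Type
  | initial
  | echo
  | ready

/-- A message on an authenticated channel. It belongs to the broadcast instance of
`tx.initiator`, and its sequence number in that instance is `tx.seq`. -/
structure Msg (N : ℕ) : Type where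
  src : Fin N
  dst : Fin N
  kind : Kind
  tx : Tx N

/-- The local state of an agent. -/
structure Local (N : ℕ) : Type where
  /-- echo messages queued for sending (to every agent) -/
  echoOut : Set (Tx N)
  /-- ready messages queued for sending (to every agent) -/
  readyOut : Set (Tx N)
  /-- for each agent, the echo messages received from it (the first one in each slot) -/
  echoIn : Fin N → Set (Tx N)
  /-- for each agent, the ready messages received from it (the first one in each slot) -/
  readyIn : Fin N → Set (Tx N)
  /-- transactions delivered by the broadcast layer (the execution buffer) -/
  delivered : Set (Tx N)
  /-- local view of the balances -/
  B : Fin N → ℝ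
  /-- sequence numbers of the last executed transaction of each agent -/
  S : Fin N → ℕ
  /-- incoming payments of each agent not yet credited to its balance -/
  Q : Fin N → Finset (Tx N)
  /-- fee credits of each agent not yet converted into balance -/
  F : Fin N → Finset (Tx N)
  /-- transaction counter -/
  ctr : ℕ
  /-- the transactions this agent has broadcast -/
  sent : Finset (Tx N)
  /-- the transactions this agent has executed -/
  executed : Finset (Tx N)
  /-- the executed transactions that this agent has marked as bad -/
  bad : Finset (Tx N)

/-- The transactions an agent has committed. -/
noncomputable def Local.committed (σ : Local N) : Finset (Tx N) := σ.executed \ σ.bad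

/-! ### Rational Reliable Broadcast -/

/-- In the instance of agent `i`, a message from `j` is present for every sequence number below
`s`. -/
def CaughtUp (In : Fin N → Set (Tx N)) (j i : Fin N) (s : ℕ) : Prop :=
  ∀ r, 1 ≤ r → r < s → ∃ u ∈ In j, u.initiator = i ∧ u.seq = r

/-- The message for `tx` from `j` has been processed: it has been received, and so have the
messages from `j` for all lower sequence numbers of the same instance. -/
def Processed (In : Fin N → Set (Tx N)) (j : Fin N) (tx : Tx N) : Prop :=
  tx ∈ In j ∧ CaughtUp In j tx.initiator tx.seq

/-- Number of agents whose echo (or ready) message for `tx` has been processed. -/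
noncomputable def count (In : Fin N → Set (Tx N)) (tx : Tx N) : ℕ :=
  {j : Fin N | Processed In j tx}.ncard

/-- Retaliation: messages for `tx` are sent to `j` only once `j`'s echo and ready messages for all
lower sequence numbers of the same instance have been received. -/
def MaySendTo (σ : Local N) (j : Fin N) (tx : Tx N) : Prop :=
  CaughtUp σ.echoIn j tx.initiator tx.seq ∧ CaughtUp σ.readyIn j tx.initiator tx.seq

/-- Enough echo messages (more than `(N + t) / 2`) or ready messages (at least `t + 1`) for
supporting `tx`. -/
def Supported (t : ℕ) (σ : Local N) (tx : Tx N) : Prop :=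
  N + t < 2 * count σ.echoIn tx ∨ t + 1 ≤ count σ.readyIn tx

open scoped Classical in
/-- Reception of a message. An initial message is accepted only from the owner of the channel and
makes the receiver queue an echo message, if it has not queued one for this slot before. -/
noncomputable def receive (σ : Local N) (m : Msg N) : Local N :=
  match m.kind with
  | .initial =>
      if m.src = m.tx.initiator then { σ with echoOut := file σ.echoOut m.tx } else σ
  | .echo => { σ with echoIn := Function.update σ.echoIn m.src (file (σ.echoIn m.src) m.tx) }
  | .ready => { σ with readyIn := Function.update σ.readyIn m.src (file (σ.readyIn m.src) m.tx) }

/-! ### The function Pay -/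

/-- `tx` is a transaction that the function Pay may construct at agent `p` in local state `σ`.
It refers to the incoming payments that were not referred to before, and, if the fee conversion
flag is set, to the fee credits that were not referred to before. -/
def PayAllowed (ε : ℝ) (p : Fin N) (σ : Local N) (tx : Tx N) : Prop :=
  tx.value + N * ε ≤ σ.B p ∧
  tx.initiator = p ∧
  tx.seq = σ.ctr ∧
  (∀ u, u ∈ tx.deps ↔ u ∈ σ.Q p ∧ ∀ v ∈ σ.sent, u ∉ v.deps) ∧
  (tx.fees = [] ∨ ∀ u, u ∈ tx.fees ↔ u ∈ σ.F p ∧ ∀ v ∈ σ.sent, u ∉ v.fees)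

/-- Effect of Pay on the local state. -/
noncomputable def pay (σ : Local N) (tx : Tx N) : Local N :=
  { σ with ctr := σ.ctr + 1, sent := insert tx σ.sent }

/-! ### The function Execute -/

/-- The payments among `tx.deps` that are credited when `tx` is executed. -/
noncomputable def creditedDeps (σ : Local N) (tx : Tx N) : Finset (Tx N) :=
  tx.deps.toFinset ∩ σ.Q tx.initiator

/-- The fee credits among `tx.fees` that are converted when `tx` is executed. -/
noncomputable def creditedFees (σ : Local N) (tx : Tx N) : Finset (Tx N) :=
  tx.fees.toFinset ∩ σ.F tx.initiator

/-- The balance of the initiator after crediting the payments and fees `tx` refers to. -/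
noncomputable def available (ε : ℝ) (σ : Local N) (tx : Tx N) : ℝ :=
  σ.B tx.initiator + ∑ u ∈ creditedDeps σ tx, (u.value : ℝ) + (creditedFees σ tx).card * ε

/-- `tx` overdrafts or refers to a bad payment. -/
def IsBad (ε : ℝ) (σ : Local N) (tx : Tx N) : Prop :=
  available ε σ tx < tx.value + N * ε ∨ ∃ u ∈ tx.deps, u ∈ σ.bad

/-- `tx` has been delivered and satisfies the three conditions for its execution: all earlier
transactions of its initiator have been executed; all transactions it refers to have been
executed; the balance of the initiator covers the fees, or `tx` converts at least `N` fee
credits. -/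
def MayExecute (ε : ℝ) (σ : Local N) (tx : Tx N) : Prop :=
  tx ∈ σ.delivered ∧
  σ.S tx.initiator + 1 = tx.seq ∧
  (∀ u, u ∈ tx.deps ∨ u ∈ tx.fees → u ∈ σ.executed) ∧
  (N * ε ≤ σ.B tx.initiator ∨ N ≤ (creditedFees σ tx).card)

open scoped Classical in
/-- Effect of Execute, including Commit if `tx` is not bad. -/
noncomputable def execute (ε : ℝ) (σ : Local N) (tx : Tx N) : Local N :=
  { σ with
    B := Function.update σ.B tx.initiator
      (available ε σ tx - (if IsBad ε σ tx then 0 else (tx.value : ℝ)) - N * ε)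
    S := Function.update σ.S tx.initiator (σ.S tx.initiator + 1)
    Q := fun j =>
      (if j = tx.initiator then σ.Q j \ creditedDeps σ tx else σ.Q j) ∪
        (if j = tx.recipient ∧ ¬ IsBad ε σ tx then {tx} else ∅)
    F := fun j => insert tx (if j = tx.initiator then σ.F j \ creditedFees σ tx else σ.F j)
    executed := insert tx σ.executed
    bad := if IsBad ε σ tx then insert tx σ.bad else σ.bad }

/-! ### The distributed system -/

/-- A configuration: the local states, and the set of all messages sent so far. -/
structure Config (N : ℕ) : Type where
  loc : Fin N → Local N
  net : Set (Msg N)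

/-- The initial configuration with initial balances `B₀`. -/
def Config.start (B₀ : Fin N → ℝ) : Config N where
  loc := fun _ =>
    { echoOut := ∅, readyOut := ∅, echoIn := fun _ => ∅, readyIn := fun _ => ∅, delivered := ∅,
      B := B₀, S := fun _ => 0, Q := fun _ => ∅, F := fun _ => ∅, ctr := 1,
      sent := ∅, executed := ∅, bad := ∅ }
  net := ∅

/-- The steps that the protocol makes an agent take on its own. -/
inductive Action (N : ℕ) : Type
  | queueEcho (tx : Tx N)
  | queueReady (tx : Tx N)
  | sendEcho (dst : Fin N) (tx : Tx N)
  | sendReady (dst : Fin N) (tx : Tx N)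
  | deliver (tx : Tx N)
  | execute (tx : Tx N)

/-- The protocol prescribes action `a` to agent `p` in configuration `c`. -/
def Enabled (t : ℕ) (ε : ℝ) (c : Config N) (p : Fin N) : Action N → Prop
  | .queueEcho tx => SlotFree (c.loc p).echoOut tx ∧ Supported t (c.loc p) tx
  | .queueReady tx => SlotFree (c.loc p).readyOut tx ∧ Supported t (c.loc p) tx
  | .sendEcho j tx =>
      tx ∈ (c.loc p).echoOut ∧ MaySendTo (c.loc p) j tx ∧ ⟨p, j, .echo, tx⟩ ∉ c.net
  | .sendReady j tx =>
      tx ∈ (c.loc p).readyOut ∧ MaySendTo (c.loc p) j tx ∧ ⟨p, j, .ready, tx⟩ ∉ c.net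
  | .deliver tx =>
      SlotFree (c.loc p).delivered tx ∧ 2 * t + 1 ≤ count (c.loc p).readyIn tx
  | .execute tx => MayExecute ε (c.loc p) tx

/-- Replace the local state of agent `p`. -/
def Config.set (c : Config N) (p : Fin N) (σ : Local N) : Config N :=
  { c with loc := Function.update c.loc p σ }

/-- The effect of action `a` of agent `p`. -/
noncomputable def perform (ε : ℝ) (c : Config N) (p : Fin N) : Action N → Config N
  | .queueEcho tx => c.set p { c.loc p with echoOut := insert tx (c.loc p).echoOut }
  | .queueReady tx => c.set p { c.loc p with readyOut := insert tx (c.loc p).readyOut }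
  | .sendEcho j tx => { c with net := insert ⟨p, j, .echo, tx⟩ c.net }
  | .sendReady j tx => { c with net := insert ⟨p, j, .ready, tx⟩ c.net }
  | .deliver tx => c.set p { c.loc p with delivered := insert tx (c.loc p).delivered }
  | .execute tx => c.set p (Hearsay.execute ε (c.loc p) tx)

/-- The events of an execution. -/
inductive Event (N : ℕ) : Type
  /-- agent `p` calls Pay and broadcasts `tx` -/
  | broadcast (p : Fin N) (tx : Tx N)
  /-- a message reaches its destination -/
  | receive (m : Msg N)
  /-- agent `p` takes a step of the protocol -/
  | act (p : Fin N) (a : Action N)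
  /-- a Byzantine agent sends an arbitrary message -/
  | byzantine (m : Msg N)
  /-- nothing happens -/
  | idle

/-- Event `e` can lead from configuration `c` to `c'`. The agents in `R` follow the protocol, all
others are Byzantine: they send arbitrary messages, but only under their own name. -/
def Step (t : ℕ) (ε : ℝ) (R : Finset (Fin N)) (c : Config N) (e : Event N) (c' : Config N) :
    Prop :=
  match e with
  | .broadcast p tx =>
      p ∈ R ∧ PayAllowed ε p (c.loc p) tx ∧
      c' = { c.set p (pay (c.loc p) tx) with
              net := c.net ∪ {m | ∃ j, m = ⟨p, j, .initial, tx⟩} }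
  | .receive m => m ∈ c.net ∧ m.dst ∈ R ∧ c' = c.set m.dst (receive (c.loc m.dst) m)
  | .act p a => p ∈ R ∧ Enabled t ε c p a ∧ c' = perform ε c p a
  | .byzantine m => m.src ∉ R ∧ c' = { c with net := insert m c.net }
  | .idle => c' = c

/-- An execution in the asynchronous model with reliable channels: the agents in `R` are the
rational agents, and they follow the protocol. Each message between agents in `R` is eventually
received, and an agent in `R` eventually takes each step that the protocol keeps prescribing. -/
structure Execution (N t : ℕ) (ε : ℝ) (B₀ : Fin N → ℝ) (R : Finset (Fin N)) : Type where
  conf : ℕ → Config N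
  event : ℕ → Event N
  start : conf 0 = Config.start B₀
  step : ∀ n, Step t ε R (conf n) (event n) (conf (n + 1))
  reliable : ∀ n, ∀ m ∈ (conf n).net, m.src ∈ R → m.dst ∈ R → ∃ k, event k = .receive m
  fair : ∀ p ∈ R, ∀ (a : Action N) (n : ℕ),
    (∀ k, n ≤ k → Enabled t ε (conf k) p a) → ∃ k, n ≤ k ∧ event k = .act p a

namespace Execution

variable {t : ℕ} {ε : ℝ} {B₀ : Fin N → ℝ} {R : Finset (Fin N)}

/-- The local state of agent `q` just before event `n`. -/
def at_ (E : Execution N t ε B₀ R) (n : ℕ) (q : Fin N) : Local N := (E.conf n).loc q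

/-- Event `n` is the broadcast of `tx` by `p`. -/
def BroadcastsAt (E : Execution N t ε B₀ R) (n : ℕ) (p : Fin N) (tx : Tx N) : Prop :=
  E.event n = .broadcast p tx

/-- Event `n` is the execution of `tx` by `q`. -/
def ExecutesAt (E : Execution N t ε B₀ R) (n : ℕ) (q : Fin N) (tx : Tx N) : Prop :=
  E.event n = .act q (.execute tx)

/-- Event `n` is the execution of `tx` by `q`, and `q` commits `tx`. -/
def CommitsAt (E : Execution N t ε B₀ R) (n : ℕ) (q : Fin N) (tx : Tx N) : Prop :=
  E.ExecutesAt n q tx ∧ ¬ IsBad ε (E.at_ n q) tx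

end Execution

/-- The amounts and fees of the transactions that the owner of `σ` has broadcast but not yet
executed. -/
noncomputable def outstanding (ε : ℝ) (σ : Local N) : ℝ :=
  ∑ u ∈ σ.sent \ σ.executed, ((u.value : ℝ) + N * ε)

end Hearsay

namespace Hearsay

variable {N t : ℕ} {ε : ℝ} {R : Finset (Fin N)} {c c' : Config N} {e : Event N}

/-! ### Slots -/

/-! Safety rests on agreement at two levels. At the broadcast level, every delivered transaction has
an echo quorum: more than (N + t) / 2 agents are Byzantine or have queued an echo for it. Two such
quorums share more than t agents, hence a rational one, and a rational agent echoes at most one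
transaction per slot. So transactions delivered in the same slot are equal (`EchoQuorum.agree`).

At the level of accounts, `AccountsInv` describes `Q` and `F` by history alone: a good payment to i,
or a fee credit of i, is still pending exactly if no executed transaction of i refers to it. Hence
the balance of a is determined by the executed transactions of a and those they refer to
(`AccountsInv.balance_eq`). Two agents with the same S[a] have executed the same transactions of a
and, by condition (2), everything these refer to, so they compute the same balance of a, however the
remaining executions are interleaved (`AccountsInv.balance_congr`). Induction on time then shows
that all agents pass the same verdict on every transaction (`badAgree`). Balances stay non-negative
because condition (3) secures the fees and only covered values are subtracted.

For liveness, retaliation makes each slot wait for the lower ones, so slots are completed by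
induction on the sequence number (`Backed.eventually_delivered`). What one agent executes, all
rational agents execute, by induction on the time of that execution: when its turn comes elsewhere,
balance and credits are the same, so condition (3) holds there too
(`ExecutesAt.eventually_executed`). It remains that the initiator executes its own transaction.
Coverage at the moment of broadcast persists, since an execution lowers the initiator's balance by
no more than it removes from the outstanding sum (`sum_unexecuted_le`). -/

theorem SameSlot.symm {u v : Tx N} (h : SameSlot u v) : SameSlot v u := ⟨h.1.symm, h.2.symm⟩

/-- Each slot is occupied by at most one element of `A`. -/
def SlotUnique (A : Set (Tx N)) : Prop := ∀ u ∈ A, ∀ v ∈ A, SameSlot u v → u = v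

/-- `A'` is `A`, or arises from `A` by filling a free slot with an element satisfying `P`. -/
def Grows (P : Tx N → Prop) (A A' : Set (Tx N)) : Prop :=
  A' = A ∨ ∃ tx, A' = insert tx A ∧ SlotFree A tx ∧ P tx

theorem Grows.subset {P : Tx N → Prop} {A A' : Set (Tx N)} (h : Grows P A A') : A ⊆ A' := by
  rcases h with rfl | ⟨tx, rfl, -, -⟩
  · exact subset_rfl
  · exact Set.subset_insert _ _

theorem Grows.mem {P : Tx N → Prop} {A A' : Set (Tx N)} (h : Grows P A A') {u : Tx N}
    (hu : u ∈ A') : u ∈ A ∨ P u := by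
  rcases h with rfl | ⟨tx, rfl, -, hP⟩
  · exact .inl hu
  · rcases hu with rfl | hu
    · exact .inr hP
    · exact .inl hu

theorem Grows.slotUnique {P : Tx N → Prop} {A A' : Set (Tx N)} (h : Grows P A A')
    (hA : SlotUnique A) : SlotUnique A' := by
  rcases h with rfl | ⟨tx, rfl, hf, -⟩
  · exact hA
  · rintro u (rfl | hu) v (rfl | hv) huv
    · rfl
    · exact absurd huv.symm (hf v hv)
    · exact absurd huv (hf u hu)
    · exact hA u hu v hv huv

theorem grows_file {P : Tx N → Prop} (A : Set (Tx N)) {tx : Tx N} (h : P tx) :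
    Grows P A (file A tx) := by
  unfold file
  split_ifs with hf
  · exact .inr ⟨tx, rfl, hf, h⟩
  · exact .inl rfl

theorem exists_sameSlot_file (A : Set (Tx N)) (tx : Tx N) : ∃ u ∈ file A tx, SameSlot u tx := by
  unfold file
  split_ifs with hf
  · exact ⟨tx, Set.mem_insert _ _, rfl, rfl⟩
  · simpa [SlotFree] using hf

/-! ### Effect of a step on each component of the local states -/

theorem Config.set_loc_self (c : Config N) (p : Fin N) (σ : Local N) : (c.set p σ).loc p = σ := by
  simp [Config.set]

theorem Config.set_loc_of_ne (c : Config N) {p q : Fin N} (σ : Local N) (h : q ≠ p) :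
    (c.set p σ).loc q = c.loc q := by
  simp [Config.set, h]

/-- How the local state of an agent can change in a step. -/
theorem Step.loc_cases (h : Step t ε R c e c') (q : Fin N) :
    c'.loc q = c.loc q ∨
    (∃ tx, e = .broadcast q tx ∧ PayAllowed ε q (c.loc q) tx ∧ c'.loc q = pay (c.loc q) tx) ∨
    (∃ m ∈ c.net, m.dst = q ∧ c'.loc q = receive (c.loc q) m) ∨
    (∃ a, e = .act q a ∧ q ∈ R ∧ Enabled t ε c q a ∧ c'.loc q = (perform ε c q a).loc q) := by
  cases e with
  | broadcast p tx =>
    obtain ⟨-, hp, rfl⟩ := h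
    by_cases hq : q = p
    · subst hq
      exact .inr (.inl ⟨tx, rfl, hp, by simp [Config.set]⟩)
    · exact .inl (by simp [Config.set, hq])
  | receive m =>
    obtain ⟨hm, -, rfl⟩ := h
    by_cases hq : q = m.dst
    · subst hq
      exact .inr (.inr (.inl ⟨m, hm, rfl, c.set_loc_self _ _⟩))
    · exact .inl (c.set_loc_of_ne _ hq)
  | act p a =>
    obtain ⟨hp, ha, rfl⟩ := h
    by_cases hq : q = p
    · subst hq
      exact .inr (.inr (.inr ⟨a, rfl, hp, ha, rfl⟩))
    · left
      cases a <;> simp [perform, Config.set, hq]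
  | byzantine m =>
    obtain ⟨-, rfl⟩ := h
    exact .inl rfl
  | idle =>
    obtain rfl := h
    exact .inl rfl

theorem Step.echoOut (h : Step t ε R c e c') (q : Fin N) :
    Grows (fun tx => ⟨tx.initiator, q, .initial, tx⟩ ∈ c.net ∨ Supported t (c.loc q) tx)
      (c.loc q).echoOut (c'.loc q).echoOut := by
  rcases h.loc_cases q with h | ⟨tx, -, -, h⟩ | ⟨⟨src, dst, kind, tx⟩, hm, rfl, h⟩ | ⟨a, -, -, ha, h⟩
  · exact .inl (by rw [h])
  · exact .inl (by rw [h]; rfl)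
  · rw [h]
    cases kind
    · simp only [receive]
      split_ifs with hs
      · subst hs
        exact grows_file _ (.inl hm)
      · exact .inl rfl
    · exact .inl rfl
    · exact .inl rfl
  · rw [h]
    cases a with
    | queueEcho tx =>
      simp only [perform, Config.set_loc_self]
      exact .inr ⟨tx, rfl, ha.1, .inr ha.2⟩
    | _ => exact .inl (by simp [perform, Config.set, execute])

theorem Step.readyOut (h : Step t ε R c e c') (q : Fin N) :
    Grows (Supported t (c.loc q)) (c.loc q).readyOut (c'.loc q).readyOut := by
  rcases h.loc_cases q with h | ⟨tx, -, -, h⟩ | ⟨⟨src, dst, kind, tx⟩, hm, rfl, h⟩ | ⟨a, -, -, ha, h⟩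
  · exact .inl (by rw [h])
  · exact .inl (by rw [h]; rfl)
  · rw [h]
    left
    cases kind
    · simp only [receive]
      split_ifs <;> rfl
    · rfl
    · rfl
  · rw [h]
    cases a with
    | queueReady tx =>
      simp only [perform, Config.set_loc_self]
      exact .inr ⟨tx, rfl, ha.1, ha.2⟩
    | _ => exact .inl (by simp [perform, Config.set, execute])

theorem Step.delivered (h : Step t ε R c e c') (q : Fin N) :
    Grows (fun tx => 2 * t + 1 ≤ count (c.loc q).readyIn tx)
      (c.loc q).delivered (c'.loc q).delivered := by
  rcases h.loc_cases q with h | ⟨tx, -, -, h⟩ | ⟨⟨src, dst, kind, tx⟩, hm, rfl, h⟩ | ⟨a, -, -, ha, h⟩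
  · exact .inl (by rw [h])
  · exact .inl (by rw [h]; rfl)
  · rw [h]
    left
    cases kind
    · simp only [receive]
      split_ifs <;> rfl
    · rfl
    · rfl
  · rw [h]
    cases a with
    | deliver tx =>
      simp only [perform, Config.set_loc_self]
      exact .inr ⟨tx, rfl, ha.1, ha.2⟩
    | _ => exact .inl (by simp [perform, Config.set, Hearsay.execute])

theorem Step.echoIn (h : Step t ε R c e c') (q j : Fin N) :
    Grows (fun tx => ⟨j, q, .echo, tx⟩ ∈ c.net) ((c.loc q).echoIn j) ((c'.loc q).echoIn j) := by
  rcases h.loc_cases q with h | ⟨tx, -, -, h⟩ | ⟨⟨src, dst, kind, tx⟩, hm, rfl, h⟩ | ⟨a, -, -, ha, h⟩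
  · exact .inl (by rw [h])
  · exact .inl (by rw [h]; rfl)
  · rw [h]
    cases kind
    · left
      simp only [receive]
      split_ifs <;> rfl
    · by_cases hj : j = src
      · subst hj
        simp only [receive, Function.update_self]
        exact grows_file _ hm
      · exact .inl (by simp [receive, hj])
    · exact .inl rfl
  · rw [h]
    cases a <;> exact .inl (by simp [perform, Config.set, Hearsay.execute])

theorem Step.readyIn (h : Step t ε R c e c') (q j : Fin N) :
    Grows (fun tx => ⟨j, q, .ready, tx⟩ ∈ c.net) ((c.loc q).readyIn j) ((c'.loc q).readyIn j) := by
  rcases h.loc_cases q with h | ⟨tx, -, -, h⟩ | ⟨⟨src, dst, kind, tx⟩, hm, rfl, h⟩ | ⟨a, -, -, ha, h⟩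
  · exact .inl (by rw [h])
  · exact .inl (by rw [h]; rfl)
  · rw [h]
    cases kind
    · left
      simp only [receive]
      split_ifs <;> rfl
    · exact .inl rfl
    · by_cases hj : j = src
      · subst hj
        simp only [receive, Function.update_self]
        exact grows_file _ hm
      · exact .inl (by simp [receive, hj])
  · rw [h]
    cases a <;> exact .inl (by simp [perform, Config.set, Hearsay.execute])

theorem Step.sent (h : Step t ε R c e c') (q : Fin N) :
    ((c'.loc q).sent = (c.loc q).sent ∧ (c'.loc q).ctr = (c.loc q).ctr) ∨
    ∃ tx, e = .broadcast q tx ∧ PayAllowed ε q (c.loc q) tx ∧ c'.loc q = pay (c.loc q) tx := by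
  rcases h.loc_cases q with h | h | ⟨⟨src, dst, kind, tx⟩, hm, rfl, h⟩ | ⟨a, -, -, ha, h⟩
  · exact .inl (by simp [h])
  · exact .inr h
  · rw [h]
    left
    cases kind
    · simp only [receive]
      split_ifs <;> exact ⟨rfl, rfl⟩
    · exact ⟨rfl, rfl⟩
    · exact ⟨rfl, rfl⟩
  · rw [h]
    cases a <;> exact .inl (by simp [perform, Config.set, Hearsay.execute])

/-- The accounts of two local states agree. -/
structure SameAccounts (σ σ' : Local N) : Prop where
  B : σ'.B = σ.B
  S : σ'.S = σ.S
  Q : σ'.Q = σ.Q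
  F : σ'.F = σ.F
  executed : σ'.executed = σ.executed
  bad : σ'.bad = σ.bad

theorem Step.accounts (h : Step t ε R c e c') (q : Fin N) :
    SameAccounts (c.loc q) (c'.loc q) ∨
    ∃ tx, e = .act q (.execute tx) ∧ MayExecute ε (c.loc q) tx ∧
      c'.loc q = Hearsay.execute ε (c.loc q) tx := by
  rcases h.loc_cases q with h | ⟨tx, -, -, h⟩ | ⟨⟨src, dst, kind, tx⟩, hm, rfl, h⟩ | ⟨a, rfl, -, ha, h⟩
  · exact .inl (by rw [h]; exact ⟨rfl, rfl, rfl, rfl, rfl, rfl⟩)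
  · exact .inl (by rw [h]; exact ⟨rfl, rfl, rfl, rfl, rfl, rfl⟩)
  · rw [h]
    left
    cases kind
    · simp only [receive]
      split_ifs <;> exact ⟨rfl, rfl, rfl, rfl, rfl, rfl⟩
    · exact ⟨rfl, rfl, rfl, rfl, rfl, rfl⟩
    · exact ⟨rfl, rfl, rfl, rfl, rfl, rfl⟩
  · rw [h]
    cases a with
    | execute tx => exact .inr ⟨tx, rfl, ha, by simp [perform, Config.set]⟩
    | _ => exact .inl (by constructor <;> simp [perform, Config.set])

/-! ### Effect of a step on the network -/

theorem Step.net_subset (h : Step t ε R c e c') : c.net ⊆ c'.net := by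
  cases e with
  | broadcast p tx =>
    obtain ⟨-, -, rfl⟩ := h
    exact Set.subset_union_left
  | receive m =>
    obtain ⟨-, -, rfl⟩ := h
    exact subset_rfl
  | act p a =>
    obtain ⟨-, -, rfl⟩ := h
    cases a <;> simp [perform, Config.set]
  | byzantine m =>
    obtain ⟨-, rfl⟩ := h
    exact Set.subset_insert _ _
  | idle =>
    obtain rfl := h
    exact subset_rfl

/-- Where the messages of the agents that follow the protocol come from. -/
theorem Step.mem_net (h : Step t ε R c e c') {p q : Fin N} {k : Kind} {tx : Tx N}
    (hm : ⟨p, q, k, tx⟩ ∈ c'.net) (hp : p ∈ R) :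
    ⟨p, q, k, tx⟩ ∈ c.net ∨ (k = .initial ∧ e = .broadcast p tx) ∨
      (k = .echo ∧ tx ∈ (c.loc p).echoOut) ∨ (k = .ready ∧ tx ∈ (c.loc p).readyOut) := by
  cases e with
  | broadcast p' tx' =>
    obtain ⟨-, -, rfl⟩ := h
    rcases hm with hm | ⟨j, hj⟩
    · exact .inl hm
    · cases hj
      exact .inr (.inl ⟨rfl, rfl⟩)
  | receive m =>
    obtain ⟨-, -, rfl⟩ := h
    exact .inl hm
  | act p' a =>
    obtain ⟨-, ha, rfl⟩ := h
    cases a with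
    | sendEcho j tx' =>
      rcases hm with hm | hm
      · cases hm
        exact .inr (.inr (.inl ⟨rfl, ha.1⟩))
      · exact .inl hm
    | sendReady j tx' =>
      rcases hm with hm | hm
      · cases hm
        exact .inr (.inr (.inr ⟨rfl, ha.1⟩))
      · exact .inl hm
    | _ => exact .inl hm
  | byzantine m =>
    obtain ⟨hs, rfl⟩ := h
    rcases hm with rfl | hm
    · exact absurd hp hs
    · exact .inl hm
  | idle =>
    obtain rfl := h
    exact .inl hm

end Hearsay

namespace Hearsay

/-! ### Counting agents -/

section Quorum

variable {N t : ℕ} {R : Finset (Fin N)}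

theorem ncard_le_of_byzantine_or {A : Set (Fin N)} (hR : Rᶜ.card ≤ t) (hA : ∀ j ∈ A, j ∉ R) :
    A.ncard ≤ t := by
  refine le_trans (Set.ncard_le_ncard (t := ((Rᶜ : Finset (Fin N)) : Set (Fin N))) ?_) ?_
  · intro j hj
    simpa using hA j hj
  · rwa [Set.ncard_coe_finset]

theorem exists_mem_rational (hR : Rᶜ.card ≤ t) {A : Set (Fin N)} (hA : t < A.ncard) :
    ∃ j ∈ A, j ∈ R := by
  by_contra! h
  exact absurd (ncard_le_of_byzantine_or hR h) (not_le.mpr hA)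

theorem ncard_le (A : Set (Fin N)) : A.ncard ≤ N := by
  simpa using Set.ncard_le_card A

/-- Two echo quorums have a rational agent in common. -/
theorem exists_mem_inter_rational (hR : Rᶜ.card ≤ t) {A A' : Set (Fin N)}
    (hA : N + t < 2 * A.ncard) (hA' : N + t < 2 * A'.ncard) : ∃ j ∈ A ∩ A', j ∈ R := by
  refine exists_mem_rational hR ?_
  -- The sizes of the two sets sum to more than N + t, and the union has at most N elements, so more
  -- than t remain for the intersection.
  have h1 := Set.ncard_inter_add_ncard_union A A'
  have h2 := ncard_le (A ∪ A')
  omega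

theorem le_card_rational (hR : Rᶜ.card ≤ t) : N ≤ R.card + t := by
  have := Finset.card_add_card_compl R
  simp only [Fintype.card_fin] at this
  omega

theorem le_count {In : Fin N → Set (Tx N)} {tx : Tx N} {A : Finset (Fin N)}
    (h : ∀ j ∈ A, Processed In j tx) : A.card ≤ count In tx := by
  rw [← Set.ncard_coe_finset]
  exact Set.ncard_le_ncard fun j hj => h j hj

end Quorum

namespace Execution

variable {N t : ℕ} {ε : ℝ} {B₀ : Fin N → ℝ} {R : Finset (Fin N)} (E : Execution N t ε B₀ R)

/-! ### Monotonicity -/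

theorem start_loc (q : Fin N) : E.at_ 0 q = (Config.start B₀).loc q := by
  rw [at_, E.start]

theorem net_mono : Monotone fun n => (E.conf n).net :=
  monotone_nat_of_le_succ fun n => (E.step n).net_subset

theorem echoOut_mono (q : Fin N) : Monotone fun n => (E.at_ n q).echoOut :=
  monotone_nat_of_le_succ fun n => ((E.step n).echoOut q).subset

theorem readyOut_mono (q : Fin N) : Monotone fun n => (E.at_ n q).readyOut :=
  monotone_nat_of_le_succ fun n => ((E.step n).readyOut q).subset

theorem delivered_mono (q : Fin N) : Monotone fun n => (E.at_ n q).delivered :=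
  monotone_nat_of_le_succ fun n => ((E.step n).delivered q).subset

theorem echoIn_mono (q j : Fin N) : Monotone fun n => (E.at_ n q).echoIn j :=
  monotone_nat_of_le_succ fun n => ((E.step n).echoIn q j).subset

theorem readyIn_mono (q j : Fin N) : Monotone fun n => (E.at_ n q).readyIn j :=
  monotone_nat_of_le_succ fun n => ((E.step n).readyIn q j).subset

theorem sent_mono (q : Fin N) : Monotone fun n => (E.at_ n q).sent := by
  refine monotone_nat_of_le_succ fun n => ?_
  rcases (E.step n).sent q with h | ⟨tx, -, -, h⟩
  · exact h.1.ge
  · change _ ⊆ ((E.conf (n + 1)).loc q).sent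
    rw [h]
    exact Finset.subset_insert _ _

theorem executed_mono (q : Fin N) : Monotone fun n => (E.at_ n q).executed := by
  refine monotone_nat_of_le_succ fun n => ?_
  rcases (E.step n).accounts q with h | ⟨tx, -, -, h⟩
  · exact h.executed.ge
  · change _ ⊆ ((E.conf (n + 1)).loc q).executed
    rw [h]
    exact Finset.subset_insert _ _

/-! ### Slots are filled at most once -/

theorem echoOut_slotUnique (n : ℕ) (q : Fin N) : SlotUnique (E.at_ n q).echoOut := by
  induction n with
  | zero =>
    rw [E.start_loc]
    rintro u ⟨⟩
  | succ n ih => exact ((E.step n).echoOut q).slotUnique ih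

theorem readyOut_slotUnique (n : ℕ) (q : Fin N) : SlotUnique (E.at_ n q).readyOut := by
  induction n with
  | zero =>
    rw [E.start_loc]
    rintro u ⟨⟩
  | succ n ih => exact ((E.step n).readyOut q).slotUnique ih

/-! ### Messages of rational agents -/

variable {E}

theorem mem_echoOut_of_mem_net {n : ℕ} {p q : Fin N} {tx : Tx N}
    (h : ⟨p, q, .echo, tx⟩ ∈ (E.conf n).net) (hp : p ∈ R) : tx ∈ (E.at_ n p).echoOut := by
  induction n with
  | zero =>
    rw [E.start] at h
    cases h
  | succ n ih =>
    refine E.echoOut_mono p (Nat.le_succ n) ?_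
    rcases (E.step n).mem_net h hp with h | h | h | h
    · exact ih h
    · cases h.1
    · exact h.2
    · cases h.1

theorem mem_readyOut_of_mem_net {n : ℕ} {p q : Fin N} {tx : Tx N}
    (h : ⟨p, q, .ready, tx⟩ ∈ (E.conf n).net) (hp : p ∈ R) : tx ∈ (E.at_ n p).readyOut := by
  induction n with
  | zero =>
    rw [E.start] at h
    cases h
  | succ n ih =>
    refine E.readyOut_mono p (Nat.le_succ n) ?_
    rcases (E.step n).mem_net h hp with h | h | h | h
    · exact ih h
    · cases h.1
    · cases h.1
    · exact h.2

/-- Channels are authenticated, so whatever is received under a rational name was queued by that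
agent. This turns counts of received messages into facts about the queues, which are unique per
slot. -/
theorem mem_echoOut_of_mem_echoIn {n : ℕ} {p q : Fin N} {tx : Tx N}
    (h : tx ∈ (E.at_ n q).echoIn p) (hp : p ∈ R) : tx ∈ (E.at_ n p).echoOut := by
  induction n with
  | zero =>
    rw [E.start_loc] at h
    cases h
  | succ n ih =>
    refine E.echoOut_mono p (Nat.le_succ n) ?_
    rcases ((E.step n).echoIn q p).mem h with h | h
    · exact ih h
    · exact mem_echoOut_of_mem_net h hp

theorem mem_readyOut_of_mem_readyIn {n : ℕ} {p q : Fin N} {tx : Tx N}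
    (h : tx ∈ (E.at_ n q).readyIn p) (hp : p ∈ R) : tx ∈ (E.at_ n p).readyOut := by
  induction n with
  | zero =>
    rw [E.start_loc] at h
    cases h
  | succ n ih =>
    refine E.readyOut_mono p (Nat.le_succ n) ?_
    rcases ((E.step n).readyIn q p).mem h with h | h
    · exact ih h
    · exact mem_readyOut_of_mem_net h hp

/-! ### Agreement of the broadcast layer -/

/-- More than `(N + t) / 2` agents are Byzantine or have queued an echo message for `tx`. -/
def EchoQuorum (E : Execution N t ε B₀ R) (n : ℕ) (tx : Tx N) : Prop :=
  N + t < 2 * {j | j ∈ R → tx ∈ (E.at_ n j).echoOut}.ncard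

theorem EchoQuorum.mono {n m : ℕ} {tx : Tx N} (h : E.EchoQuorum n tx) (hnm : n ≤ m) :
    E.EchoQuorum m tx := by
  refine lt_of_lt_of_le h (Nat.mul_le_mul_left 2 (Set.ncard_le_ncard ?_))
  exact fun j hj hR => E.echoOut_mono j hnm (hj hR)

theorem echoQuorum_of_echo_count {n : ℕ} {q : Fin N} {tx : Tx N}
    (h : N + t < 2 * count (E.at_ n q).echoIn tx) : E.EchoQuorum n tx := by
  refine lt_of_lt_of_le h (Nat.mul_le_mul_left 2 (Set.ncard_le_ncard ?_))
  exact fun j hj hR => mem_echoOut_of_mem_echoIn hj.1 hR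

theorem exists_readyOut_of_ready_count (hR : Rᶜ.card ≤ t) {n : ℕ} {q : Fin N} {tx : Tx N}
    (h : t + 1 ≤ count (E.at_ n q).readyIn tx) : ∃ j ∈ R, tx ∈ (E.at_ n j).readyOut := by
  obtain ⟨j, hj, hjR⟩ := exists_mem_rational hR h
  exact ⟨j, hjR, mem_readyOut_of_mem_readyIn hj.1 hjR⟩

/-- Among t + 1 ready messages one is from a rational agent, which queued it earlier. Tracing back
in time therefore ends at an agent that saw enough echo messages. -/
theorem echoQuorum_of_mem_readyOut (hR : Rᶜ.card ≤ t) {n : ℕ} {q : Fin N} {tx : Tx N}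
    (h : tx ∈ (E.at_ n q).readyOut) : E.EchoQuorum n tx := by
  induction n generalizing q with
  | zero =>
    rw [E.start_loc] at h
    cases h
  | succ n ih =>
    refine EchoQuorum.mono ?_ (Nat.le_succ n)
    rcases ((E.step n).readyOut q).mem h with h | h | h
    · exact ih h
    · exact echoQuorum_of_echo_count h
    · obtain ⟨j, -, hj⟩ := exists_readyOut_of_ready_count hR h
      exact ih hj

/-- A delivered transaction has been backed by a set of `t + 1` rational agents. -/
theorem exists_backers_of_mem_delivered (hR : Rᶜ.card ≤ t) {n : ℕ} {q : Fin N} {tx : Tx N}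
    (h : tx ∈ (E.at_ n q).delivered) :
    ∃ A ⊆ R, t + 1 ≤ A.card ∧ ∀ p ∈ A, tx ∈ (E.at_ n p).readyOut := by
  classical
  induction n with
  | zero =>
    rw [E.start_loc] at h
    cases h
  | succ n ih =>
    suffices ∃ A ⊆ R, t + 1 ≤ A.card ∧ ∀ p ∈ A, tx ∈ (E.at_ n p).readyOut by
      obtain ⟨A, h1, h2, h3⟩ := this
      exact ⟨A, h1, h2, fun p hp => E.readyOut_mono p (Nat.le_succ n) (h3 p hp)⟩
    rcases ((E.step n).delivered q).mem h with h | h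
    · exact ih h
    · refine ⟨R.filter fun p => tx ∈ (E.at_ n p).readyOut, Finset.filter_subset _ _, ?_,
        fun p hp => (Finset.mem_filter.mp hp).2⟩
      -- At most t of the 2t + 1 senders are Byzantine, which leaves t + 1 rational ones.
      have hsub : {j | Processed (E.at_ n q).readyIn j tx} ⊆
          (((R.filter fun p => tx ∈ (E.at_ n p).readyOut) ∪ Rᶜ : Finset (Fin N)) :
            Set (Fin N)) := by
        intro j hj
        by_cases hjR : j ∈ R
        · simp [hjR, mem_readyOut_of_mem_readyIn hj.1 hjR]
        · simp [hjR]
      have h1 := Set.ncard_le_ncard hsub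
      rw [Set.ncard_coe_finset] at h1
      have h2 := Finset.card_union_le (R.filter fun p => tx ∈ (E.at_ n p).readyOut) Rᶜ
      have h3 : 2 * t + 1 ≤ {j | Processed (E.at_ n q).readyIn j tx}.ncard := h
      omega

theorem echoQuorum_of_mem_delivered (hR : Rᶜ.card ≤ t) {n : ℕ} {q : Fin N} {tx : Tx N}
    (h : tx ∈ (E.at_ n q).delivered) : E.EchoQuorum n tx := by
  obtain ⟨A, -, hA, h⟩ := exists_backers_of_mem_delivered hR h
  obtain ⟨p, hp⟩ := Finset.card_pos.mp (lt_of_lt_of_le (Nat.succ_pos t) hA)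
  exact echoQuorum_of_mem_readyOut hR (h p hp)

theorem EchoQuorum.agree (hR : Rᶜ.card ≤ t) {n m : ℕ} {u v : Tx N} (hu : E.EchoQuorum n u)
    (hv : E.EchoQuorum m v) (huv : SameSlot u v) : u = v := by
  obtain ⟨j, ⟨hj, hj'⟩, hjR⟩ := exists_mem_inter_rational hR (hu.mono (le_max_left n m))
    (hv.mono (le_max_right n m))
  exact E.echoOut_slotUnique _ j u (hj hjR) v (hj' hjR) huv

theorem EchoQuorum.exists_mem_echoOut (ht : 3 * t < N) (hR : Rᶜ.card ≤ t) {n : ℕ} {u : Tx N}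
    (hu : E.EchoQuorum n u) : ∃ j ∈ R, u ∈ (E.at_ n j).echoOut := by
  obtain ⟨j, hj, hjR⟩ := exists_mem_rational hR
    (A := {j | j ∈ R → u ∈ (E.at_ n j).echoOut}) (by unfold EchoQuorum at hu; omega)
  exact ⟨j, hjR, hj hjR⟩

/-! ### Integrity: transactions of rational initiators -/

theorem mem_sent_of_initial_mem_net {n : ℕ} {p q : Fin N} {tx : Tx N}
    (h : ⟨p, q, .initial, tx⟩ ∈ (E.conf n).net) (hp : p ∈ R) : tx ∈ (E.at_ n p).sent := by
  induction n with
  | zero =>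
    rw [E.start] at h
    cases h
  | succ n ih =>
    rcases (E.step n).mem_net h hp with h | h | h | h
    · exact E.sent_mono p (Nat.le_succ n) (ih h)
    · have hs := E.step n
      rw [h.2] at hs
      obtain ⟨-, -, hs⟩ := hs
      rw [at_, hs]
      simp [Config.set, pay]
    · cases h.1
    · cases h.1

/-- Either kind of support for an echo presupposes an earlier echo by a rational agent. The chain
ends at an initial message, which nobody can forge in the name of a rational initiator. -/
theorem mem_sent_of_mem_echoOut (ht : 3 * t < N) (hR : Rᶜ.card ≤ t) {n : ℕ} {q : Fin N}
    {tx : Tx N} (h : tx ∈ (E.at_ n q).echoOut) (htx : tx.initiator ∈ R) :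
    tx ∈ (E.at_ n tx.initiator).sent := by
  induction n generalizing q with
  | zero =>
    rw [E.start_loc] at h
    cases h
  | succ n ih =>
    refine E.sent_mono _ (Nat.le_succ n) ?_
    have hq : E.EchoQuorum n tx → tx ∈ (E.at_ n tx.initiator).sent := fun hq => by
      obtain ⟨j, -, hj⟩ := hq.exists_mem_echoOut ht hR
      exact ih hj
    rcases ((E.step n).echoOut q).mem h with h | h | h | h
    · exact ih h
    · exact mem_sent_of_initial_mem_net h htx
    · exact hq (echoQuorum_of_echo_count h)
    · obtain ⟨j, -, hj⟩ := exists_readyOut_of_ready_count hR h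
      exact hq (echoQuorum_of_mem_readyOut hR hj)

theorem exists_broadcastsAt_of_mem_sent {n : ℕ} {p : Fin N} {tx : Tx N}
    (h : tx ∈ (E.at_ n p).sent) : ∃ m < n, E.BroadcastsAt m p tx := by
  induction n with
  | zero =>
    rw [E.start_loc] at h
    simp [Config.start] at h
  | succ n ih =>
    rcases (E.step n).sent p with h' | ⟨tx', he, -, h'⟩
    · rw [at_, h'.1] at h
      obtain ⟨m, hm, hb⟩ := ih h
      exact ⟨m, by omega, hb⟩
    · rw [at_, h', pay, Finset.mem_insert] at h
      rcases h with rfl | h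
      · exact ⟨n, by omega, he⟩
      · obtain ⟨m, hm, hb⟩ := ih h
        exact ⟨m, by omega, hb⟩

theorem BroadcastsAt.payAllowed {n : ℕ} {p : Fin N} {tx : Tx N} (h : E.BroadcastsAt n p tx) :
    p ∈ R ∧ PayAllowed ε p (E.at_ n p) tx ∧ E.at_ (n + 1) p = pay (E.at_ n p) tx ∧
      ∀ j, ⟨p, j, .initial, tx⟩ ∈ (E.conf (n + 1)).net := by
  have hs := E.step n
  rw [h] at hs
  obtain ⟨hp, ha, hs⟩ := hs
  refine ⟨hp, ha, ?_, fun j => ?_⟩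
  · rw [at_, hs]
    simp [Config.set, at_]
  · rw [hs]
    exact .inr ⟨j, rfl⟩

theorem BroadcastsAt.mem_sent {n : ℕ} {p : Fin N} {tx : Tx N} (h : E.BroadcastsAt n p tx) :
    tx ∈ (E.at_ (n + 1) p).sent := by
  rw [h.payAllowed.2.2.1]
  exact Finset.mem_insert_self _ _

/-- The sequence numbers used by an agent are `1, 2, …, ctr - 1`. -/
theorem sent_seq (E : Execution N t ε B₀ R) (n : ℕ) (p : Fin N) :
    1 ≤ (E.at_ n p).ctr ∧
    (∀ u ∈ (E.at_ n p).sent, u.initiator = p ∧ 1 ≤ u.seq ∧ u.seq < (E.at_ n p).ctr) ∧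
    (∀ r, 1 ≤ r → r < (E.at_ n p).ctr → ∃ u ∈ (E.at_ n p).sent, u.seq = r) ∧
    (∀ u ∈ (E.at_ n p).sent, ∀ v ∈ (E.at_ n p).sent, u.seq = v.seq → u = v) := by
  induction n with
  | zero =>
    rw [E.start_loc]
    simp only [Config.start, Finset.notMem_empty, false_imp_iff, implies_true, true_and, and_true,
      le_refl]
    intro r h1 h2
    omega
  | succ n ih =>
    obtain ⟨h1, h2, h3, h4⟩ := ih
    rcases (E.step n).sent p with ⟨hs, hc⟩ | ⟨tx, -, hp, h⟩
    · rw [at_, hs, hc]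
      exact ⟨h1, h2, h3, h4⟩
    · rw [at_, h]
      obtain ⟨-, hi, hseq, -⟩ := hp
      simp only [at_] at h1 h2 h3 h4
      simp only [pay, Finset.mem_insert]
      refine ⟨by omega, ?_, fun r hr hr' => ?_, ?_⟩
      · rintro u (rfl | hu)
        · exact ⟨hi, by omega, by omega⟩
        · obtain ⟨a, b, c⟩ := h2 u hu
          exact ⟨a, b, by omega⟩
      · by_cases hr2 : r < ((E.conf n).loc p).ctr
        · obtain ⟨u, hu, hur⟩ := h3 r hr hr2
          exact ⟨u, .inr hu, hur⟩
        · exact ⟨tx, .inl rfl, by omega⟩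
      · rintro u (rfl | hu) v (rfl | hv) huv
        · rfl
        · have := (h2 v hv).2.2
          omega
        · have := (h2 u hu).2.2
          omega
        · exact h4 u hu v hv huv

end Execution

end Hearsay

namespace Hearsay

variable {N : ℕ} {ε : ℝ} {B₀ : Fin N → ℝ} {σ σ' : Local N} {tx : Tx N}

/-! ### The accounts of one agent -/

/-- What holds for the accounts in the view of every agent at all times. -/
structure AccountsInv (ε : ℝ) (B₀ : Fin N → ℝ) (σ : Local N) : Prop where
  nonneg : ∀ i, 0 ≤ σ.B i
  seq : ∀ u ∈ σ.executed, 1 ≤ u.seq ∧ u.seq ≤ σ.S u.initiator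
  filled : ∀ i r, 1 ≤ r → r ≤ σ.S i → ∃ u ∈ σ.executed, u.initiator = i ∧ u.seq = r
  refs : ∀ v ∈ σ.executed, ∀ u, u ∈ v.deps ∨ u ∈ v.fees → u ∈ σ.executed
  bad_subset : σ.bad ⊆ σ.executed
  mem_Q : ∀ i u, u ∈ σ.Q i ↔ u ∈ σ.executed ∧ u ∉ σ.bad ∧ u.recipient = i ∧
    ∀ v ∈ σ.executed, v.initiator = i → u ∉ v.deps
  mem_F : ∀ i u, u ∈ σ.F i ↔ u ∈ σ.executed ∧ ∀ v ∈ σ.executed, v.initiator = i → u ∉ v.fees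
  total : ∀ i, σ.B i + ∑ u ∈ σ.Q i, (u.value : ℝ) + (σ.F i).card * ε =
    B₀ i + ∑ u ∈ σ.committed with u.recipient = i, (u.value : ℝ) + σ.executed.card * ε
      - ∑ u ∈ σ.committed with u.initiator = i, (u.value : ℝ)
      - (σ.executed.filter (fun u => u.initiator = i)).card * (N * ε)

theorem AccountsInv.congr (h : AccountsInv ε B₀ σ) (hs : SameAccounts σ σ') :
    AccountsInv ε B₀ σ' := by
  obtain ⟨hB, hS, hQ, hF, he, hb⟩ := hs
  obtain ⟨h1, h2, h3, h4, h5, h6, h7, h8⟩ := h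
  constructor
  · rwa [hB]
  · rwa [he, hS]
  · rwa [he, hS]
  · rwa [he]
  · rwa [he, hb]
  · rwa [he, hQ, hb]
  · rwa [he, hF]
  · simp only [Local.committed] at h8 ⊢
    rwa [he, hF, hQ, hb, hB]

theorem accountsInv_start (hε : 0 ≤ ε) (hB₀ : ∀ i, N * ε < B₀ i) (q : Fin N) :
    AccountsInv ε B₀ ((Config.start B₀).loc q) := by
  have h0 : ∀ i, 0 ≤ B₀ i := fun i => le_trans (by positivity) (hB₀ i).le
  constructor <;> simp [Config.start, h0, Local.committed]
  intro i r h1 h2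
  omega

theorem available_eq_add (ε : ℝ) (σ : Local N) (tx : Tx N) :
    available ε σ tx = σ.B tx.initiator + ∑ u ∈ creditedDeps σ tx, (u.value : ℝ)
      + (creditedFees σ tx).card * ε := rfl

theorem le_available (hε : 0 ≤ ε) : σ.B tx.initiator ≤ available ε σ tx := by
  have h1 : 0 ≤ ∑ u ∈ creditedDeps σ tx, (u.value : ℝ) := Finset.sum_nonneg fun u _ => u.value.2
  have h2 : 0 ≤ (creditedFees σ tx).card * ε := by positivity
  unfold available
  linarith

/-- The available balance covers the fees of every executed transaction. -/
theorem AccountsInv.fees_le_available (hI : AccountsInv ε B₀ σ) (hε : 0 ≤ ε)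
    (hm : MayExecute ε σ tx) : N * ε ≤ available ε σ tx := by
  obtain ⟨-, -, -, h | h⟩ := hm
  · exact h.trans (le_available hε)
  · have h1 : 0 ≤ ∑ u ∈ creditedDeps σ tx, (u.value : ℝ) :=
      Finset.sum_nonneg fun u _ => u.value.2
    have h2 : (N : ℝ) * ε ≤ (creditedFees σ tx).card * ε :=
      mul_le_mul_of_nonneg_right (by exact_mod_cast h) hε
    have := hI.nonneg tx.initiator
    unfold available
    linarith

/-- Executed transactions have sequence number at most S, while condition (1) asks for S + 1. -/
theorem AccountsInv.notMem_executed (hI : AccountsInv ε B₀ σ) (hm : MayExecute ε σ tx) :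
    tx ∉ σ.executed := fun h => by
  have h1 := (hI.seq tx h).2
  have h2 := hm.2.1
  omega

theorem mem_execute_bad {u : Tx N} :
    u ∈ (execute ε σ tx).bad ↔ u ∈ σ.bad ∨ (u = tx ∧ IsBad ε σ tx) := by
  simp only [execute]
  split_ifs with h <;> simp [h, or_comm]

theorem mem_execute_executed {u : Tx N} :
    u ∈ (execute ε σ tx).executed ↔ u = tx ∨ u ∈ σ.executed := by
  simp [execute]

theorem mem_creditedDeps {u : Tx N} :
    u ∈ creditedDeps σ tx ↔ u ∈ tx.deps ∧ u ∈ σ.Q tx.initiator := by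
  simp [creditedDeps]

theorem mem_creditedFees {u : Tx N} :
    u ∈ creditedFees σ tx ↔ u ∈ tx.fees ∧ u ∈ σ.F tx.initiator := by
  simp [creditedFees]

theorem execute_committed (hb : σ.bad ⊆ σ.executed) (htx : tx ∉ σ.executed) :
    (IsBad ε σ tx → (execute ε σ tx).committed = σ.committed) ∧
    (¬ IsBad ε σ tx → (execute ε σ tx).committed = insert tx σ.committed) := by
  have htb : tx ∉ σ.bad := fun h => htx (hb h)
  constructor
  · intro h
    ext u
    simp only [Local.committed, Finset.mem_sdiff, mem_execute_executed, mem_execute_bad]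
    by_cases hu : u = tx
    · subst hu
      simp [h, htx]
    · simp [hu]
  · intro h
    ext u
    simp only [Local.committed, Finset.mem_insert, Finset.mem_sdiff, mem_execute_executed,
      mem_execute_bad]
    by_cases hu : u = tx
    · subst hu
      simp [h, htb]
    · simp [hu]

/-- The executed set is closed under references and does not contain `tx` yet. Hence neither `tx`
nor any executed transaction refers to `tx`, and if it is good it starts out as an uncredited
payment. All other changes concern the entries of `Q` that `tx` itself refers to. -/
theorem AccountsInv.execute_mem_Q (hI : AccountsInv ε B₀ σ) (hm : MayExecute ε σ tx) (i : Fin N)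
    (u : Tx N) : u ∈ (execute ε σ tx).Q i ↔
      u ∈ (execute ε σ tx).executed ∧ u ∉ (execute ε σ tx).bad ∧ u.recipient = i ∧
        ∀ v ∈ (execute ε σ tx).executed, v.initiator = i → u ∉ v.deps := by
  have htx := hI.notMem_executed hm
  have htb : tx ∉ σ.bad := fun h => htx (hI.bad_subset h)
  have hQ : u ∈ (execute ε σ tx).Q i ↔
      (u ∈ σ.Q i ∧ (i = tx.initiator → u ∉ tx.deps)) ∨
        (u = tx ∧ i = tx.recipient ∧ ¬ IsBad ε σ tx) := by
    simp only [execute, Finset.mem_union]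
    by_cases h1 : i = tx.initiator
    · subst h1
      by_cases h2 : tx.initiator = tx.recipient ∧ ¬ IsBad ε σ tx
      · simp only [if_true, if_pos h2, Finset.mem_sdiff, mem_creditedDeps, Finset.mem_singleton]
        tauto
      · simp only [if_true, if_neg h2, Finset.mem_sdiff, mem_creditedDeps, Finset.notMem_empty]
        tauto
    · by_cases h2 : i = tx.recipient ∧ ¬ IsBad ε σ tx
      · simp only [if_neg h1, if_pos h2, Finset.mem_singleton]
        tauto
      · simp only [if_neg h1, if_neg h2, Finset.notMem_empty]
        tauto
  have htd : tx ∉ tx.deps := fun h => htx (hm.2.2.1 tx (.inl h))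
  have hvd : ∀ v ∈ σ.executed, tx ∉ v.deps := fun v hv h => htx (hI.refs v hv tx (.inl h))
  rw [hQ, hI.mem_Q]
  simp only [mem_execute_executed, mem_execute_bad, forall_eq_or_imp]
  by_cases hu : u = tx
  · subst hu
    simp only [htx, false_and, true_and, false_or, true_or, htb, htd, not_false_eq_true,
      implies_true]
    constructor
    · rintro ⟨h1, h2⟩
      exact ⟨h2, h1.symm, fun v hv _ => hvd v hv⟩
    · rintro ⟨h1, h2, -⟩
      exact ⟨h2.symm, h1⟩
  · simp only [hu, false_and, or_false, false_or]
    constructor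
    · rintro ⟨⟨h1, h2, h3, h4⟩, h5⟩
      exact ⟨h1, h2, h3, fun h => h5 h.symm, h4⟩
    · rintro ⟨h1, h2, h3, h4, h5⟩
      exact ⟨⟨h1, h2, h3, h5⟩, fun h => h4 h.symm⟩

theorem AccountsInv.execute_mem_F (hI : AccountsInv ε B₀ σ) (hm : MayExecute ε σ tx) (i : Fin N)
    (u : Tx N) : u ∈ (execute ε σ tx).F i ↔
      u ∈ (execute ε σ tx).executed ∧
        ∀ v ∈ (execute ε σ tx).executed, v.initiator = i → u ∉ v.fees := by
  have htx := hI.notMem_executed hm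
  have hF : u ∈ (execute ε σ tx).F i ↔
      u = tx ∨ (u ∈ σ.F i ∧ (i = tx.initiator → u ∉ tx.fees)) := by
    simp only [execute, Finset.mem_insert]
    by_cases h1 : i = tx.initiator
    · subst h1
      simp only [if_true, Finset.mem_sdiff, mem_creditedFees]
      tauto
    · simp [h1]
  have htd : tx ∉ tx.fees := fun h => htx (hm.2.2.1 tx (.inr h))
  have hvd : ∀ v ∈ σ.executed, tx ∉ v.fees := fun v hv h => htx (hI.refs v hv tx (.inr h))
  rw [hF, hI.mem_F]
  simp only [mem_execute_executed, forall_eq_or_imp]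
  by_cases hu : u = tx
  · subst hu
    simp only [true_or, htd, not_false_eq_true, implies_true, true_and, true_iff]
    exact fun v hv _ => hvd v hv
  · simp only [hu, false_or]
    constructor
    · rintro ⟨⟨h1, h2⟩, h5⟩
      exact ⟨h1, fun h => h5 h.symm, h2⟩
    · rintro ⟨h1, h4, h5⟩
      exact ⟨⟨h1, h5⟩, fun h => h4 h.symm⟩

open scoped Classical in
theorem AccountsInv.execute_sum_Q (hI : AccountsInv ε B₀ σ) (hm : MayExecute ε σ tx) (i : Fin N) :
    ∑ u ∈ (execute ε σ tx).Q i, (u.value : ℝ) = ∑ u ∈ σ.Q i, (u.value : ℝ)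
      - (if i = tx.initiator then ∑ u ∈ creditedDeps σ tx, (u.value : ℝ) else 0)
      + (if i = tx.recipient ∧ ¬ IsBad ε σ tx then (tx.value : ℝ) else 0) := by
  have htx := hI.notMem_executed hm
  have htQ : tx ∉ σ.Q i := fun h => htx ((hI.mem_Q i tx).mp h).1
  have hsub : creditedDeps σ tx ⊆ σ.Q tx.initiator := Finset.inter_subset_right
  simp only [execute]
  rw [Finset.sum_union]
  · congr 1
    · split_ifs with h
      · subst h
        rw [← Finset.sum_sdiff hsub]
        ring
      · ring
    · split_ifs <;> simp
  · rw [Finset.disjoint_left]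
    intro u hu hu'
    have hu'' : u = tx := by
      split_ifs at hu'
      · simpa using hu'
      · simp at hu'
    subst hu''
    split_ifs at hu
    · exact htQ (Finset.mem_sdiff.mp hu).1
    · exact htQ hu

theorem AccountsInv.execute_card_F (hI : AccountsInv ε B₀ σ) (hm : MayExecute ε σ tx) (i : Fin N) :
    (((execute ε σ tx).F i).card : ℝ) = (σ.F i).card + 1
      - (if i = tx.initiator then ((creditedFees σ tx).card : ℝ) else 0) := by
  have htx := hI.notMem_executed hm
  have htF : tx ∉ σ.F i := fun h => htx ((hI.mem_F i tx).mp h).1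
  have hsub : creditedFees σ tx ⊆ σ.F tx.initiator := Finset.inter_subset_right
  simp only [execute]
  rw [Finset.card_insert_of_notMem]
  · split_ifs with h
    · subst h
      have := Finset.card_sdiff_add_card_eq_card hsub
      push_cast [← this]
      ring
    · push_cast
      ring
  · split_ifs
    · exact fun h => htF (Finset.mem_sdiff.mp h).1
    · exact htF

open scoped Classical in
-- The map `f` stands for recipient or initiator, so that one computation serves both sums in the
-- balance equation.
theorem AccountsInv.execute_sum_committed (hI : AccountsInv ε B₀ σ) (hm : MayExecute ε σ tx)
    (f : Tx N → Fin N) (i : Fin N) :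
    ∑ u ∈ (execute ε σ tx).committed with f u = i, (u.value : ℝ) =
      ∑ u ∈ σ.committed with f u = i, (u.value : ℝ)
        + (if i = f tx ∧ ¬ IsBad ε σ tx then (tx.value : ℝ) else 0) := by
  have htx := hI.notMem_executed hm
  obtain ⟨h1, h2⟩ := execute_committed (ε := ε) hI.bad_subset htx
  have htc : tx ∉ σ.committed := fun h => htx (Finset.mem_sdiff.mp h).1
  by_cases hb : IsBad ε σ tx
  · simp [h1 hb, hb]
  · rw [h2 hb, Finset.filter_insert]
    by_cases hi : f tx = i
    · rw [if_pos hi, Finset.sum_insert (by simp [htc]), if_pos ⟨hi.symm, hb⟩]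
      ring
    · rw [if_neg hi, if_neg (fun h => hi h.1.symm), add_zero]

theorem AccountsInv.execute (hI : AccountsInv ε B₀ σ) (hε : 0 ≤ ε) (hm : MayExecute ε σ tx) :
    AccountsInv ε B₀ (execute ε σ tx) := by
  classical
  have htx := hI.notMem_executed hm
  have hseq := hm.2.1
  have hS : ∀ i, (Hearsay.execute ε σ tx).S i = σ.S i + if i = tx.initiator then 1 else 0 := by
    intro i
    by_cases h : i = tx.initiator
    · subst h
      simp [Hearsay.execute]
    · simp [Hearsay.execute, h]
  have hB : ∀ i, (Hearsay.execute ε σ tx).B i = if i = tx.initiator then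
      available ε σ tx - (if IsBad ε σ tx then 0 else (tx.value : ℝ)) - N * ε else σ.B i := by
    intro i
    by_cases h : i = tx.initiator
    · subst h
      simp [Hearsay.execute]
    · simp [Hearsay.execute, h]
  constructor
  · intro i
    rw [hB]
    -- A bad transaction costs only the fees, which are covered; one that is not bad does not
    -- overdraft, so its value is covered as well.
    have h1 := hI.fees_le_available hε hm
    split_ifs with h h2
    · linarith
    · have h3 : ¬ available ε σ tx < tx.value + N * ε := fun h3 => h2 (.inl h3)
      linarith
    · exact hI.nonneg i
  · intro u hu
    rw [hS]
    rcases mem_execute_executed.mp hu with rfl | hu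
    · simp only [if_true]
      omega
    · have := hI.seq u hu
      split_ifs <;> omega
  · intro i r h1 h2
    rw [hS] at h2
    simp only [mem_execute_executed]
    by_cases hr : r ≤ σ.S i
    · obtain ⟨u, hu, hu'⟩ := hI.filled i r h1 hr
      exact ⟨u, .inr hu, hu'⟩
    · split_ifs at h2 with hi
      · subst hi
        exact ⟨tx, .inl rfl, rfl, by omega⟩
      · omega
  · intro v hv u hu
    rw [mem_execute_executed] at hv ⊢
    rcases hv with rfl | hv
    · exact .inr (hm.2.2.1 u hu)
    · exact .inr (hI.refs v hv u hu)
  · intro u hu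
    rw [mem_execute_executed]
    rcases mem_execute_bad.mp hu with hu | ⟨hu, -⟩
    · exact .inr (hI.bad_subset hu)
    · exact .inl hu
  · exact hI.execute_mem_Q hm
  · exact hI.execute_mem_F hm
  · intro i
    have hT := hI.total i
    rw [hI.execute_sum_Q hm, hI.execute_card_F hm,
      hI.execute_sum_committed hm (fun u => u.recipient),
      hI.execute_sum_committed hm (fun u => u.initiator), hB]
    have hc : ((Hearsay.execute ε σ tx).executed.card : ℝ) = σ.executed.card + 1 := by
      change ((insert tx σ.executed).card : ℝ) = _
      rw [Finset.card_insert_of_notMem htx]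
      push_cast
      rfl
    have hc' : (((Hearsay.execute ε σ tx).executed.filter fun u => u.initiator = i).card : ℝ) =
        (σ.executed.filter fun u => u.initiator = i).card
          + if i = tx.initiator then 1 else 0 := by
      change (((insert tx σ.executed).filter fun u => u.initiator = i).card : ℝ) = _
      rw [Finset.filter_insert]
      by_cases h : tx.initiator = i
      · rw [if_pos h, if_pos h.symm, Finset.card_insert_of_notMem (by simp [htx])]
        push_cast
        rfl
      · rw [if_neg h, if_neg (fun h' => h h'.symm), add_zero]
    rw [hc, hc']
    by_cases h1 : i = tx.initiator
    · subst h1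
      have := available_eq_add ε σ tx
      by_cases hb : IsBad ε σ tx
      · simp only [hb, if_true, not_true, and_false, if_false]
        linarith
      · simp only [hb, if_true, if_false, not_false_eq_true, and_true]
        linarith
    · simp only [h1, if_false, false_and]
      linarith

/-! ### Comparing the accounts of two agents -/

/-- The executed transactions of two agents never compete for a slot. -/
def ExecutedAgree (σ σ' : Local N) : Prop :=
  ∀ u ∈ σ.executed, ∀ v ∈ σ'.executed, SameSlot u v → u = v

/-- Two agents mark the same transactions as bad, among those both of them have executed. -/
def BadAgree (σ σ' : Local N) : Prop :=
  ∀ u ∈ σ.executed, u ∈ σ'.executed → (u ∈ σ.bad ↔ u ∈ σ'.bad)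

/-- The second agent has filled every slot up to its counter, and by agreement its occupant of this
slot is `v`. -/
theorem AccountsInv.executed_of_le (hI : AccountsInv ε B₀ σ) (hI' : AccountsInv ε B₀ σ')
    (hag : ExecutedAgree σ σ') {v : Tx N} (hv : v ∈ σ.executed)
    (hle : v.seq ≤ σ'.S v.initiator) : v ∈ σ'.executed := by
  obtain ⟨u, hu, hu'⟩ := hI'.filled v.initiator v.seq (hI.seq v hv).1 hle
  rwa [hag v hv u hu ⟨hu'.1.symm, hu'.2.symm⟩]

theorem AccountsInv.executed_iff (hI : AccountsInv ε B₀ σ) (hI' : AccountsInv ε B₀ σ')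
    (hag : ExecutedAgree σ σ') {a : Fin N} (hS : σ.S a = σ'.S a) {v : Tx N}
    (hv : v.initiator = a) : v ∈ σ.executed ↔ v ∈ σ'.executed := by
  subst hv
  constructor
  · intro h
    exact hI.executed_of_le hI' hag h (hS ▸ (hI.seq v h).2)
  · intro h
    exact hI'.executed_of_le hI (fun u hu w hw huw => (hag w hw u hu huw.symm).symm) h
      (hS.symm ▸ (hI'.seq v h).2)

open scoped Classical in
/-- The balance of an agent in terms of its executed transactions. -/
theorem AccountsInv.balance_eq (hI : AccountsInv ε B₀ σ) (a : Fin N) :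
    σ.B a = B₀ a
      + ∑ u ∈ σ.executed with u ∉ σ.bad ∧ u.recipient = a ∧
          ∃ v ∈ σ.executed, v.initiator = a ∧ u ∈ v.deps, (u.value : ℝ)
      + (σ.executed.filter fun u => ∃ v ∈ σ.executed, v.initiator = a ∧ u ∈ v.fees).card * ε
      - ∑ u ∈ σ.executed with u ∉ σ.bad ∧ u.initiator = a, (u.value : ℝ)
      - (σ.executed.filter (fun u => u.initiator = a)).card * (N * ε) := by
  have hT := hI.total a
  -- A committed payment to `a` is either still in `Q` or referred to by an executed transaction of
  -- `a`, and never both.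
  have h1 : ∑ u ∈ σ.committed with u.recipient = a, (u.value : ℝ) =
      ∑ u ∈ σ.Q a, (u.value : ℝ) + ∑ u ∈ σ.executed with u ∉ σ.bad ∧ u.recipient = a ∧
          ∃ v ∈ σ.executed, v.initiator = a ∧ u ∈ v.deps, (u.value : ℝ) := by
    rw [← Finset.sum_union]
    · refine Finset.sum_congr ?_ fun _ _ => rfl
      ext u
      simp only [Finset.mem_filter, Local.committed, Finset.mem_sdiff, Finset.mem_union, hI.mem_Q]
      by_cases h : ∃ v ∈ σ.executed, v.initiator = a ∧ u ∈ v.deps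
      · have : ¬ ∀ v ∈ σ.executed, v.initiator = a → u ∉ v.deps := by simpa using h
        tauto
      · have : ∀ v ∈ σ.executed, v.initiator = a → u ∉ v.deps := by simpa using h
        tauto
    · rw [Finset.disjoint_left]
      intro u hu hu'
      obtain ⟨v, hv, hva, huv⟩ := (Finset.mem_filter.mp hu').2.2.2
      exact ((hI.mem_Q a u).mp hu).2.2.2 v hv hva huv
  have h2 : (σ.executed.card : ℝ) = (σ.F a).card +
      (σ.executed.filter fun u => ∃ v ∈ σ.executed, v.initiator = a ∧ u ∈ v.fees).card := by
    have hF : σ.F a = σ.executed.filter fun u =>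
        ¬ ∃ v ∈ σ.executed, v.initiator = a ∧ u ∈ v.fees := by
      ext u
      simp [hI.mem_F]
    have := Finset.card_filter_add_card_filter_not (s := σ.executed)
      (fun u => ∃ v ∈ σ.executed, v.initiator = a ∧ u ∈ v.fees)
    rw [hF, ← this]
    push_cast
    ring
  have h3 : ∑ u ∈ σ.committed with u.initiator = a, (u.value : ℝ) =
      ∑ u ∈ σ.executed with u ∉ σ.bad ∧ u.initiator = a, (u.value : ℝ) := by
    refine Finset.sum_congr ?_ fun _ _ => rfl
    ext u
    simp only [Finset.mem_filter, Local.committed, Finset.mem_sdiff]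
    tauto
  rw [h1, h2, h3] at hT
  linarith

/-- The right-hand side of `balance_eq` mentions only transactions of `a` and those they refer to.
The former coincide because the counters do; the latter have been executed by both agents because
executed sets are closed under references. -/
theorem AccountsInv.balance_congr (hI : AccountsInv ε B₀ σ) (hI' : AccountsInv ε B₀ σ')
    (hag : ExecutedAgree σ σ') (hbad : BadAgree σ σ') {a : Fin N} (hS : σ.S a = σ'.S a) :
    σ.B a = σ'.B a := by
  classical
  have hex : ∀ v, v.initiator = a → (v ∈ σ.executed ↔ v ∈ σ'.executed) :=
    fun v hv => hI.executed_iff hI' hag hS hv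
  have h1 : (σ.executed.filter fun u => u ∉ σ.bad ∧ u.recipient = a ∧
      ∃ v ∈ σ.executed, v.initiator = a ∧ u ∈ v.deps) =
      σ'.executed.filter fun u => u ∉ σ'.bad ∧ u.recipient = a ∧
      ∃ v ∈ σ'.executed, v.initiator = a ∧ u ∈ v.deps := by
    ext u
    simp only [Finset.mem_filter]
    constructor
    · rintro ⟨h1, h2, h3, v, hv, hva, huv⟩
      have hv' := (hex v hva).mp hv
      have hu' := hI'.refs v hv' u (.inl huv)
      exact ⟨hu', fun h => h2 ((hbad u h1 hu').mpr h), h3, v, hv', hva, huv⟩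
    · rintro ⟨h1, h2, h3, v, hv, hva, huv⟩
      have hv' := (hex v hva).mpr hv
      have hu' := hI.refs v hv' u (.inl huv)
      exact ⟨hu', fun h => h2 ((hbad u hu' h1).mp h), h3, v, hv', hva, huv⟩
  have h2 : (σ.executed.filter fun u => ∃ v ∈ σ.executed, v.initiator = a ∧ u ∈ v.fees) =
      σ'.executed.filter fun u => ∃ v ∈ σ'.executed, v.initiator = a ∧ u ∈ v.fees := by
    ext u
    simp only [Finset.mem_filter]
    constructor
    · rintro ⟨-, v, hv, hva, huv⟩
      have hv' := (hex v hva).mp hv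
      exact ⟨hI'.refs v hv' u (.inr huv), v, hv', hva, huv⟩
    · rintro ⟨-, v, hv, hva, huv⟩
      have hv' := (hex v hva).mpr hv
      exact ⟨hI.refs v hv' u (.inr huv), v, hv', hva, huv⟩
  have h3 : (σ.executed.filter fun u => u ∉ σ.bad ∧ u.initiator = a) =
      σ'.executed.filter fun u => u ∉ σ'.bad ∧ u.initiator = a := by
    ext u
    simp only [Finset.mem_filter]
    constructor
    · rintro ⟨h1, h2, h3⟩
      have hu' := (hex u h3).mp h1
      exact ⟨hu', fun h => h2 ((hbad u h1 hu').mpr h), h3⟩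
    · rintro ⟨h1, h2, h3⟩
      have hu' := (hex u h3).mpr h1
      exact ⟨hu', fun h => h2 ((hbad u hu' h1).mp h), h3⟩
  have h4 : (σ.executed.filter fun u => u.initiator = a) =
      σ'.executed.filter fun u => u.initiator = a := by
    ext u
    simp only [Finset.mem_filter]
    exact ⟨fun h => ⟨(hex u h.2).mp h.1, h.2⟩, fun h => ⟨(hex u h.2).mpr h.1, h.2⟩⟩
  rw [hI.balance_eq a, hI'.balance_eq a, h1, h2, h3, h4]

/-- All that Execute computes for `tx` is the same for two agents that have executed everything
`tx` refers to, and all earlier transactions of its initiator. -/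
theorem AccountsInv.execute_congr (hI : AccountsInv ε B₀ σ) (hI' : AccountsInv ε B₀ σ')
    (hag : ExecutedAgree σ σ') (hbad : BadAgree σ σ') (hS : σ.S tx.initiator = σ'.S tx.initiator)
    (href : ∀ u, u ∈ tx.deps ∨ u ∈ tx.fees → u ∈ σ.executed)
    (href' : ∀ u, u ∈ tx.deps ∨ u ∈ tx.fees → u ∈ σ'.executed) :
    creditedDeps σ tx = creditedDeps σ' tx ∧ creditedFees σ tx = creditedFees σ' tx ∧
      σ.B tx.initiator = σ'.B tx.initiator ∧ (IsBad ε σ tx ↔ IsBad ε σ' tx) := by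
  have hex : ∀ v, v.initiator = tx.initiator → (v ∈ σ.executed ↔ v ∈ σ'.executed) :=
    fun v hv => hI.executed_iff hI' hag hS hv
  -- The histories behind `Q` and `F` quantify only over transactions of the initiator, which are
  -- common to both agents.
  have hall : ∀ P : Tx N → Prop, (∀ v ∈ σ.executed, v.initiator = tx.initiator → P v) ↔
      ∀ v ∈ σ'.executed, v.initiator = tx.initiator → P v := fun P =>
    ⟨fun h v hv hva => h v ((hex v hva).mpr hv) hva, fun h v hv hva => h v ((hex v hva).mp hv) hva⟩
  have hB := hI.balance_congr hI' hag hbad hS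
  have hD : creditedDeps σ tx = creditedDeps σ' tx := by
    ext u
    rw [mem_creditedDeps, mem_creditedDeps, hI.mem_Q, hI'.mem_Q, hall fun v => u ∉ v.deps]
    refine and_congr_right fun hu => ?_
    have h1 := href u (.inl hu)
    have h2 := href' u (.inl hu)
    rw [hbad u h1 h2]
    simp [h1, h2]
  have hF : creditedFees σ tx = creditedFees σ' tx := by
    ext u
    rw [mem_creditedFees, mem_creditedFees, hI.mem_F, hI'.mem_F, hall fun v => u ∉ v.fees]
    refine and_congr_right fun hu => ?_
    simp [href u (.inr hu), href' u (.inr hu)]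
  refine ⟨hD, hF, hB, ?_⟩
  have hA : available ε σ tx = available ε σ' tx := by
    unfold available
    rw [hD, hF, hB]
  unfold IsBad
  rw [hA]
  refine or_congr_right (exists_congr fun u => and_congr_right fun hu => ?_)
  exact hbad u (href u (.inl hu)) (href' u (.inl hu))

end Hearsay

namespace Hearsay

namespace Execution

/-! ### Executed transactions -/

variable {N t : ℕ} {ε : ℝ} {B₀ : Fin N → ℝ} {R : Finset (Fin N)} {E : Execution N t ε B₀ R}

theorem accountsInv (hε : 0 ≤ ε) (hB₀ : ∀ i, N * ε < B₀ i) (E : Execution N t ε B₀ R) (n : ℕ)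
    (q : Fin N) : AccountsInv ε B₀ (E.at_ n q) := by
  induction n with
  | zero =>
    rw [E.start_loc]
    exact accountsInv_start hε hB₀ q
  | succ n ih =>
    rcases (E.step n).accounts q with h | ⟨tx, -, hm, h⟩
    · exact ih.congr h
    · rw [at_, h]
      exact ih.execute hε hm

theorem ExecutesAt.mayExecute {n : ℕ} {q : Fin N} {tx : Tx N} (h : E.ExecutesAt n q tx) :
    MayExecute ε (E.at_ n q) tx ∧ E.at_ (n + 1) q = Hearsay.execute ε (E.at_ n q) tx := by
  have hs := E.step n
  rw [h] at hs
  obtain ⟨-, hm, hs⟩ := hs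
  refine ⟨hm, ?_⟩
  rw [at_, hs]
  simp [perform, Config.set, at_]

theorem ExecutesAt.mem_executed {n m : ℕ} {q : Fin N} {tx : Tx N} (h : E.ExecutesAt n q tx)
    (hnm : n < m) : tx ∈ (E.at_ m q).executed := by
  refine E.executed_mono q (Nat.succ_le_of_lt hnm) ?_
  change tx ∈ (E.at_ (n + 1) q).executed
  rw [h.mayExecute.2, mem_execute_executed]
  exact .inl rfl

theorem exists_executesAt_of_mem_executed {n : ℕ} {q : Fin N} {tx : Tx N}
    (h : tx ∈ (E.at_ n q).executed) : ∃ m < n, E.ExecutesAt m q tx := by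
  induction n with
  | zero =>
    rw [E.start_loc] at h
    simp [Config.start] at h
  | succ n ih =>
    rcases (E.step n).accounts q with h' | ⟨tx', he, -, h'⟩
    · rw [at_, h'.executed] at h
      obtain ⟨m, hm, hb⟩ := ih h
      exact ⟨m, by omega, hb⟩
    · rw [at_, h', mem_execute_executed] at h
      rcases h with rfl | h
      · exact ⟨n, by omega, he⟩
      · obtain ⟨m, hm, hb⟩ := ih h
        exact ⟨m, by omega, hb⟩

theorem mem_delivered_of_mem_executed {n : ℕ} {q : Fin N} {tx : Tx N}
    (h : tx ∈ (E.at_ n q).executed) : tx ∈ (E.at_ n q).delivered := by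
  obtain ⟨m, hm, h⟩ := exists_executesAt_of_mem_executed h
  exact E.delivered_mono q hm.le h.mayExecute.1.1

theorem executedAgree (hR : Rᶜ.card ≤ t) (E : Execution N t ε B₀ R) (n m : ℕ) (p q : Fin N) :
    ExecutedAgree (E.at_ n p) (E.at_ m q) := fun _ hu _ hv huv =>
  (echoQuorum_of_mem_delivered hR (mem_delivered_of_mem_executed hu)).agree hR
    (echoQuorum_of_mem_delivered hR (mem_delivered_of_mem_executed hv)) huv

theorem ExecutesAt.eq_of_sameSlot (hR : Rᶜ.card ≤ t) {n m : ℕ} {p q : Fin N} {u v : Tx N}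
    (hu : E.ExecutesAt n p u) (hv : E.ExecutesAt m q v) (huv : SameSlot u v) : u = v :=
  executedAgree hR E (n + 1) (m + 1) p q u (hu.mem_executed n.lt_succ_self) v
    (hv.mem_executed m.lt_succ_self) huv

theorem ExecutesAt.not_lt (hε : 0 ≤ ε) (hB₀ : ∀ i, N * ε < B₀ i) {n m : ℕ} {q : Fin N} {tx : Tx N}
    (h : E.ExecutesAt n q tx) (h' : E.ExecutesAt m q tx) : ¬ n < m := fun hnm =>
  (accountsInv hε hB₀ E m q).notMem_executed h'.mayExecute.1 (h.mem_executed hnm)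

/-- A verdict is never revised, as no transaction is executed twice. So membership in `bad` at any
later time records the verdict at the time of execution. -/
theorem ExecutesAt.mem_bad_iff (hε : 0 ≤ ε) (hB₀ : ∀ i, N * ε < B₀ i) {n m : ℕ} {q : Fin N}
    {tx : Tx N} (h : E.ExecutesAt n q tx) (hnm : n < m) :
    tx ∈ (E.at_ m q).bad ↔ IsBad ε (E.at_ n q) tx := by
  induction m, hnm using Nat.le_induction with
  | base =>
    have hI := accountsInv hε hB₀ E n q
    have : tx ∉ (E.at_ n q).bad := fun hb =>
      hI.notMem_executed h.mayExecute.1 (hI.bad_subset hb)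
    simp [h.mayExecute.2, mem_execute_bad, this]
  | succ m hnm ih =>
    rw [← ih]
    rcases (E.step m).accounts q with h' | ⟨tx', he, -, h'⟩
    · rw [at_, h'.bad, at_]
    · have hne : tx ≠ tx' := by
        rintro rfl
        exact h.not_lt hε hB₀ he hnm
      rw [at_, h', mem_execute_bad]
      simp [hne, at_]

theorem S_eq_of_executesAt {n m : ℕ} {p q : Fin N} {tx : Tx N} (h : E.ExecutesAt n p tx)
    (h' : E.ExecutesAt m q tx) :
    (E.at_ n p).S tx.initiator = (E.at_ m q).S tx.initiator := by
  have h1 := h.mayExecute.1.2.1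
  have h2 := h'.mayExecute.1.2.1
  omega

/-- Induction on the time of the first agent alone, with the time of the second arbitrary. A verdict
depends on verdicts on references that were executed before, so the comparison is made at the two
moments of execution. -/
theorem badAgree (hR : Rᶜ.card ≤ t) (hε : 0 ≤ ε) (hB₀ : ∀ i, N * ε < B₀ i)
    (E : Execution N t ε B₀ R) (n m : ℕ) (p q : Fin N) :
    BadAgree (E.at_ n p) (E.at_ m q) := by
  induction n generalizing m with
  | zero =>
    rw [E.start_loc]
    intro u hu
    simp [Config.start] at hu
  | succ n ih =>
    rcases (E.step n).accounts p with h | ⟨tx, he, -, h⟩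
    · intro u hu hu'
      rw [at_, h.executed] at hu
      rw [at_, h.bad]
      exact ih m u hu hu'
    · intro u hu hu'
      have he' : E.ExecutesAt n p tx := he
      by_cases hutx : u = tx
      · subst hutx
        obtain ⟨k, hk, hq⟩ := exists_executesAt_of_mem_executed hu'
        rw [he'.mem_bad_iff hε hB₀ n.lt_succ_self, hq.mem_bad_iff hε hB₀ hk]
        -- Here `k` is the moment at which `q` executed `u`; the induction hypothesis is used at
        -- `k`, not at `m`.
        exact ((accountsInv hε hB₀ E n p).execute_congr (accountsInv hε hB₀ E k q)
          (executedAgree hR E n k p q) (ih k) (S_eq_of_executesAt he' hq) he'.mayExecute.1.2.2.1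
          hq.mayExecute.1.2.2.1).2.2.2
      · rw [at_, h, mem_execute_executed] at hu
        rw [at_, h, mem_execute_bad]
        simp only [hutx, false_or, false_and, or_false] at hu ⊢
        exact ih m u hu hu'

theorem ExecutesAt.isBad_iff (hR : Rᶜ.card ≤ t) (hε : 0 ≤ ε) (hB₀ : ∀ i, N * ε < B₀ i) {n m : ℕ}
    {p q : Fin N} {tx : Tx N} (h : E.ExecutesAt n p tx) (h' : E.ExecutesAt m q tx) :
    IsBad ε (E.at_ n p) tx ↔ IsBad ε (E.at_ m q) tx :=
  ((accountsInv hε hB₀ E n p).execute_congr (accountsInv hε hB₀ E m q)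
    (executedAgree hR E n m p q) (badAgree hR hε hB₀ E n m p q) (S_eq_of_executesAt h h')
    h.mayExecute.1.2.2.1 h'.mayExecute.1.2.2.1).2.2.2

/-- Of two executed transactions of the same initiator, the earlier one has been executed by
whoever executes the later one. -/
theorem ExecutesAt.mem_executed_of_seq_lt (hR : Rᶜ.card ≤ t) (hε : 0 ≤ ε)
    (hB₀ : ∀ i, N * ε < B₀ i) {n m : ℕ} {p q : Fin N} {tx tx' : Tx N} (h : E.ExecutesAt n p tx)
    (h' : E.ExecutesAt m q tx') (hi : tx.initiator = tx'.initiator) (hs : tx.seq < tx'.seq) :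
    tx ∈ (E.at_ m q).executed := by
  refine (accountsInv hε hB₀ E (n + 1) p).executed_of_le (accountsInv hε hB₀ E m q)
    (executedAgree hR E (n + 1) m p q) (h.mem_executed n.lt_succ_self) ?_
  have := h'.mayExecute.1.2.1
  rw [hi]
  omega

/-- Both initiators are the recipient of `u`, so the two transactions lie in one sequence. Whoever
executes the later one has executed the earlier one, and then `u` is no longer in `Q`. -/
theorem eq_of_mem_creditedDeps (hR : Rᶜ.card ≤ t) (hε : 0 ≤ ε) (hB₀ : ∀ i, N * ε < B₀ i)
    {n m : ℕ} {p q : Fin N} {tx tx' u : Tx N} (h : E.ExecutesAt n p tx)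
    (h' : E.ExecutesAt m q tx') (hu : u ∈ creditedDeps (E.at_ n p) tx)
    (hu' : u ∈ creditedDeps (E.at_ m q) tx') : tx = tx' := by
  rw [mem_creditedDeps, (accountsInv hε hB₀ E _ _).mem_Q] at hu hu'
  obtain ⟨hd, -, -, hr, hf⟩ := hu
  obtain ⟨hd', -, -, hr', hf'⟩ := hu'
  have hi : tx.initiator = tx'.initiator := hr.symm.trans hr'
  rcases lt_trichotomy tx.seq tx'.seq with hs | hs | hs
  · exact absurd hd (hf' tx (h.mem_executed_of_seq_lt hR hε hB₀ h' hi hs) hi)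
  · exact h.eq_of_sameSlot hR h' ⟨hi, hs⟩
  · exact absurd hd' (hf tx' (h'.mem_executed_of_seq_lt hR hε hB₀ h hi.symm hs) hi.symm)

/-- As for payments, except that every agent owns a fee credit for `u`, so equality of the
initiators has to be assumed. -/
theorem eq_of_mem_creditedFees (hR : Rᶜ.card ≤ t) (hε : 0 ≤ ε) (hB₀ : ∀ i, N * ε < B₀ i)
    {n m : ℕ} {p q : Fin N} {tx tx' u : Tx N} (h : E.ExecutesAt n p tx)
    (h' : E.ExecutesAt m q tx') (hi : tx.initiator = tx'.initiator)
    (hu : u ∈ creditedFees (E.at_ n p) tx) (hu' : u ∈ creditedFees (E.at_ m q) tx') :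
    tx = tx' := by
  rw [mem_creditedFees, (accountsInv hε hB₀ E _ _).mem_F] at hu hu'
  obtain ⟨hd, -, hf⟩ := hu
  obtain ⟨hd', -, hf'⟩ := hu'
  rcases lt_trichotomy tx.seq tx'.seq with hs | hs | hs
  · exact absurd hd (hf' tx (h.mem_executed_of_seq_lt hR hε hB₀ h' hi hs) hi)
  · exact h.eq_of_sameSlot hR h' ⟨hi, hs⟩
  · exact absurd hd' (hf tx' (h'.mem_executed_of_seq_lt hR hε hB₀ h hi.symm hs) hi.symm)

theorem ExecutesAt.exists_broadcastsAt (ht : 3 * t < N) (hR : Rᶜ.card ≤ t) {n : ℕ} {q : Fin N}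
    {tx : Tx N} (h : E.ExecutesAt n q tx) (htx : tx.initiator ∈ R) :
    ∃ m < n, E.BroadcastsAt m tx.initiator tx := by
  obtain ⟨j, -, hj⟩ :=
    (echoQuorum_of_mem_delivered hR h.mayExecute.1.1).exists_mem_echoOut ht hR
  exact exists_broadcastsAt_of_mem_sent (mem_sent_of_mem_echoOut ht hR hj htx)

end Execution

end Hearsay

namespace Hearsay

namespace Execution

open Filter

variable {N t : ℕ} {ε : ℝ} {B₀ : Fin N → ℝ} {R : Finset (Fin N)} {E : Execution N t ε B₀ R}

/-! ### Liveness of the single steps -/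

theorem eventually_of_mono {P : ℕ → Prop} (hP : ∀ n, P n → P (n + 1)) {n : ℕ} (h : P n) :
    ∀ᶠ k in atTop, P k :=
  eventually_atTop.mpr ⟨n, fun _ hk => Nat.le_induction h (fun m _ => hP m) _ hk⟩

theorem eventually_mem {α : Type*} {s : ℕ → Set α} (hs : Monotone s) {n : ℕ} {x : α}
    (h : x ∈ s n) : ∀ᶠ k in atTop, x ∈ s k :=
  eventually_atTop.mpr ⟨n, fun _ hk => hs hk h⟩

/-- If agent `p` should take action `a` as long as `P` does not hold, and the action makes `P`
true forever, then `P` holds eventually. -/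
theorem eventually_of_fair {p : Fin N} (hp : p ∈ R) (a : Action N) {P : ℕ → Prop}
    (hP : ∀ n, P n → P (n + 1))
    (hen : ∀ᶠ k in atTop, ¬ P k → Enabled t ε (E.conf k) p a)
    (hact : ∀ k, E.event k = .act p a → P (k + 1)) : ∀ᶠ k in atTop, P k := by
  by_contra hcon
  have hnP : ∀ k, ¬ P k := fun k hk => hcon (eventually_of_mono hP hk)
  obtain ⟨n, hn⟩ := eventually_atTop.mp hen
  obtain ⟨k, -, hk⟩ := E.fair p hp a n fun k hk => hn k hk (hnP k)
  exact hnP _ (hact k hk)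

theorem conf_succ_of_act {k : ℕ} {p : Fin N} {a : Action N} (h : E.event k = .act p a) :
    E.conf (k + 1) = perform ε (E.conf k) p a := by
  have hs := E.step k
  rw [h] at hs
  exact hs.2.2

theorem eventually_send_echo {p : Fin N} (hp : p ∈ R) (q : Fin N) {tx : Tx N}
    (h : ∀ᶠ k in atTop, tx ∈ (E.at_ k p).echoOut)
    (hs : ∀ᶠ k in atTop, MaySendTo (E.at_ k p) q tx) :
    ∀ᶠ k in atTop, ⟨p, q, .echo, tx⟩ ∈ (E.conf k).net := by
  refine eventually_of_fair (E := E) hp (.sendEcho q tx) (fun n hn => E.net_mono n.le_succ hn) ?_ ?_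
  · filter_upwards [h, hs] with k h1 h2 h3 using ⟨h1, h2, h3⟩
  · intro k hk
    rw [conf_succ_of_act hk]
    exact Set.mem_insert _ _

theorem eventually_send_ready {p : Fin N} (hp : p ∈ R) (q : Fin N) {tx : Tx N}
    (h : ∀ᶠ k in atTop, tx ∈ (E.at_ k p).readyOut)
    (hs : ∀ᶠ k in atTop, MaySendTo (E.at_ k p) q tx) :
    ∀ᶠ k in atTop, ⟨p, q, .ready, tx⟩ ∈ (E.conf k).net := by
  refine eventually_of_fair (E := E) hp (.sendReady q tx) (fun n hn => E.net_mono n.le_succ hn) ?_ ?_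
  · filter_upwards [h, hs] with k h1 h2 h3 using ⟨h1, h2, h3⟩
  · intro k hk
    rw [conf_succ_of_act hk]
    exact Set.mem_insert _ _

theorem at_succ_of_receive {k : ℕ} {m : Msg N} (h : E.event k = .receive m) :
    E.at_ (k + 1) m.dst = receive (E.at_ k m.dst) m := by
  have hs := E.step k
  rw [h] at hs
  rw [at_, hs.2.2, Config.set_loc_self, at_]

/-- On arrival the message is dropped if its slot is occupied. The occupant also came from the queue
of `p`, which holds one transaction per slot, so it is `tx` itself. -/
theorem eventually_receive_echo {p q : Fin N} (hp : p ∈ R) (hq : q ∈ R) {tx : Tx N}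
    (h : ∀ᶠ k in atTop, ⟨p, q, .echo, tx⟩ ∈ (E.conf k).net) :
    ∀ᶠ k in atTop, tx ∈ (E.at_ k q).echoIn p := by
  obtain ⟨n, hn⟩ := h.exists
  obtain ⟨k, hk⟩ := E.reliable n _ hn hp hq
  obtain ⟨u, hu, hs⟩ := exists_sameSlot_file ((E.at_ k q).echoIn p) tx
  have hu' : u ∈ (E.at_ (k + 1) q).echoIn p := by
    have := at_succ_of_receive hk
    simp only at this
    rw [this]
    simpa [receive] using hu
  have : u = tx := by
    refine E.echoOut_slotUnique (max n (k + 1)) p u ?_ tx ?_ hs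
    · exact E.echoOut_mono p (le_max_right _ _) (mem_echoOut_of_mem_echoIn hu' hp)
    · exact E.echoOut_mono p (le_max_left _ _) (mem_echoOut_of_mem_net hn hp)
  subst this
  exact eventually_mem (E.echoIn_mono q p) hu'

theorem eventually_receive_ready {p q : Fin N} (hp : p ∈ R) (hq : q ∈ R) {tx : Tx N}
    (h : ∀ᶠ k in atTop, ⟨p, q, .ready, tx⟩ ∈ (E.conf k).net) :
    ∀ᶠ k in atTop, tx ∈ (E.at_ k q).readyIn p := by
  obtain ⟨n, hn⟩ := h.exists
  obtain ⟨k, hk⟩ := E.reliable n _ hn hp hq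
  obtain ⟨u, hu, hs⟩ := exists_sameSlot_file ((E.at_ k q).readyIn p) tx
  have hu' : u ∈ (E.at_ (k + 1) q).readyIn p := by
    have := at_succ_of_receive hk
    simp only at this
    rw [this]
    simpa [receive] using hu
  have : u = tx := by
    refine E.readyOut_slotUnique (max n (k + 1)) p u ?_ tx ?_ hs
    · exact E.readyOut_mono p (le_max_right _ _) (mem_readyOut_of_mem_readyIn hu' hp)
    · exact E.readyOut_mono p (le_max_left _ _) (mem_readyOut_of_mem_net hn hp)
  subst this
  exact eventually_mem (E.readyIn_mono q p) hu'

/-- Among the sets of a monotone family, some set and hence all later ones occupy the slot of `tx`,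
always by the same element. -/
theorem exists_eventually_mem_of_not_slotFree {s : ℕ → Set (Tx N)} (hs : Monotone s) {tx : Tx N}
    (h : ∀ᶠ k in atTop, ¬ SlotFree (s k) tx) :
    ∃ u, SameSlot u tx ∧ ∀ᶠ k in atTop, u ∈ s k := by
  obtain ⟨n, hn⟩ := h.exists
  simp only [SlotFree, not_forall, not_not] at hn
  obtain ⟨u, hu, hus⟩ := hn
  exact ⟨u, hus, eventually_mem hs hu⟩

theorem not_slotFree_mono {s : ℕ → Set (Tx N)} (hs : Monotone s) (tx : Tx N) (n : ℕ)
    (h : ¬ SlotFree (s n) tx) : ¬ SlotFree (s (n + 1)) tx :=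
  fun hf => h fun u hu => hf u (hs n.le_succ hu)

theorem not_slotFree_insert (A : Set (Tx N)) (tx : Tx N) : ¬ SlotFree (insert tx A) tx :=
  fun h => h tx (Set.mem_insert _ _) ⟨rfl, rfl⟩

/-- Only some occupant of the slot is obtained, since an equivocating initiator may have caused an
echo of another transaction before `tx` found support. -/
theorem eventually_queue_echo {p : Fin N} (hp : p ∈ R) {tx : Tx N}
    (h : ∀ᶠ k in atTop, Supported t (E.at_ k p) tx) :
    ∃ u, SameSlot u tx ∧ ∀ᶠ k in atTop, u ∈ (E.at_ k p).echoOut := by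
  refine exists_eventually_mem_of_not_slotFree (E.echoOut_mono p) ?_
  refine eventually_of_fair (E := E) hp (.queueEcho tx) (not_slotFree_mono (E.echoOut_mono p) tx) ?_ ?_
  · filter_upwards [h] with k h1 h2 using ⟨not_not.mp h2, h1⟩
  · intro k hk
    rw [at_, conf_succ_of_act hk, perform, Config.set_loc_self]
    exact not_slotFree_insert _ _

theorem eventually_queue_ready {p : Fin N} (hp : p ∈ R) {tx : Tx N}
    (h : ∀ᶠ k in atTop, Supported t (E.at_ k p) tx) :
    ∃ u, SameSlot u tx ∧ ∀ᶠ k in atTop, u ∈ (E.at_ k p).readyOut := by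
  refine exists_eventually_mem_of_not_slotFree (E.readyOut_mono p) ?_
  refine eventually_of_fair (E := E) hp (.queueReady tx) (not_slotFree_mono (E.readyOut_mono p) tx) ?_ ?_
  · filter_upwards [h] with k h1 h2 using ⟨not_not.mp h2, h1⟩
  · intro k hk
    rw [at_, conf_succ_of_act hk, perform, Config.set_loc_self]
    exact not_slotFree_insert _ _

theorem eventually_deliver {p : Fin N} (hp : p ∈ R) {tx : Tx N}
    (h : ∀ᶠ k in atTop, 2 * t + 1 ≤ count (E.at_ k p).readyIn tx) :
    ∃ u, SameSlot u tx ∧ ∀ᶠ k in atTop, u ∈ (E.at_ k p).delivered := by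
  refine exists_eventually_mem_of_not_slotFree (E.delivered_mono p) ?_
  refine eventually_of_fair (E := E) hp (.deliver tx) (not_slotFree_mono (E.delivered_mono p) tx) ?_ ?_
  · filter_upwards [h] with k h1 h2 using ⟨not_not.mp h2, h1⟩
  · intro k hk
    rw [at_, conf_succ_of_act hk, perform, Config.set_loc_self]
    exact not_slotFree_insert _ _

/-! ### Completing the slots of a broadcast instance -/

/-- Eventually all rational agents have received each other's echo and ready messages for sequence
number `r` of the instance of `i`. -/
def SlotDone (E : Execution N t ε B₀ R) (i : Fin N) (r : ℕ) : Prop :=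
  ∀ p ∈ R, ∀ q ∈ R, ∀ᶠ k in atTop,
    (∃ u ∈ (E.at_ k q).echoIn p, u.initiator = i ∧ u.seq = r) ∧
    (∃ u ∈ (E.at_ k q).readyIn p, u.initiator = i ∧ u.seq = r)

/-- Eventually `tx` has echo messages queued by all rational agents, or ready messages queued by
`t + 1` of them. -/
def Backed (E : Execution N t ε B₀ R) (tx : Tx N) : Prop :=
  (∀ p ∈ R, ∀ᶠ k in atTop, tx ∈ (E.at_ k p).echoOut) ∨
  ∃ A ⊆ R, t + 1 ≤ A.card ∧ ∀ p ∈ A, ∀ᶠ k in atTop, tx ∈ (E.at_ k p).readyOut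

theorem eventually_caughtUp {i : Fin N} {s : ℕ} (h : ∀ r, 1 ≤ r → r < s → E.SlotDone i r)
    {p q : Fin N} (hp : p ∈ R) (hq : q ∈ R) : ∀ᶠ k in atTop,
      CaughtUp (E.at_ k q).echoIn p i s ∧ CaughtUp (E.at_ k q).readyIn p i s := by
  have : ∀ᶠ k in atTop, ∀ r ∈ Finset.Ico 1 s,
      (∃ u ∈ (E.at_ k q).echoIn p, u.initiator = i ∧ u.seq = r) ∧
      (∃ u ∈ (E.at_ k q).readyIn p, u.initiator = i ∧ u.seq = r) := by
    rw [Filter.eventually_all_finset]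
    intro r hr
    rw [Finset.mem_Ico] at hr
    exact h r hr.1 hr.2 p hp q hq
  filter_upwards [this] with k hk
  exact ⟨fun r h1 h2 => (hk r (Finset.mem_Ico.mpr ⟨h1, h2⟩)).1,
    fun r h1 h2 => (hk r (Finset.mem_Ico.mpr ⟨h1, h2⟩)).2⟩

theorem eventually_mem_echoIn {tx : Tx N}
    (h : ∀ r, 1 ≤ r → r < tx.seq → E.SlotDone tx.initiator r) {p q : Fin N} (hp : p ∈ R)
    (hq : q ∈ R) (ho : ∀ᶠ k in atTop, tx ∈ (E.at_ k p).echoOut) :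
    ∀ᶠ k in atTop, tx ∈ (E.at_ k q).echoIn p :=
  eventually_receive_echo hp hq (eventually_send_echo hp q ho (eventually_caughtUp h hq hp))

theorem eventually_mem_readyIn {tx : Tx N}
    (h : ∀ r, 1 ≤ r → r < tx.seq → E.SlotDone tx.initiator r) {p q : Fin N} (hp : p ∈ R)
    (hq : q ∈ R) (ho : ∀ᶠ k in atTop, tx ∈ (E.at_ k p).readyOut) :
    ∀ᶠ k in atTop, tx ∈ (E.at_ k q).readyIn p :=
  eventually_receive_ready hp hq (eventually_send_ready hp q ho (eventually_caughtUp h hq hp))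

theorem eventually_le_count_echo {tx : Tx N}
    (h : ∀ r, 1 ≤ r → r < tx.seq → E.SlotDone tx.initiator r) {A : Finset (Fin N)} (hA : A ⊆ R)
    (ho : ∀ p ∈ A, ∀ᶠ k in atTop, tx ∈ (E.at_ k p).echoOut) {q : Fin N} (hq : q ∈ R) :
    ∀ᶠ k in atTop, A.card ≤ count (E.at_ k q).echoIn tx := by
  have : ∀ᶠ k in atTop, ∀ p ∈ A, Processed (E.at_ k q).echoIn p tx := by
    rw [Filter.eventually_all_finset]
    intro p hp
    filter_upwards [eventually_mem_echoIn h (hA hp) hq (ho p hp),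
      eventually_caughtUp h (hA hp) hq] with k h1 h2 using ⟨h1, h2.1⟩
  filter_upwards [this] with k hk using le_count hk

theorem eventually_le_count_ready {tx : Tx N}
    (h : ∀ r, 1 ≤ r → r < tx.seq → E.SlotDone tx.initiator r) {A : Finset (Fin N)} (hA : A ⊆ R)
    (ho : ∀ p ∈ A, ∀ᶠ k in atTop, tx ∈ (E.at_ k p).readyOut) {q : Fin N} (hq : q ∈ R) :
    ∀ᶠ k in atTop, A.card ≤ count (E.at_ k q).readyIn tx := by
  have : ∀ᶠ k in atTop, ∀ p ∈ A, Processed (E.at_ k q).readyIn p tx := by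
    rw [Filter.eventually_all_finset]
    intro p hp
    filter_upwards [eventually_mem_readyIn h (hA hp) hq (ho p hp),
      eventually_caughtUp h (hA hp) hq] with k h1 h2 using ⟨h1, h2.2⟩
  filter_upwards [this] with k hk using le_count hk

theorem Backed.eventually_supported (ht : 3 * t < N) (hR : Rᶜ.card ≤ t) {tx : Tx N}
    (hb : E.Backed tx) (h : ∀ r, 1 ≤ r → r < tx.seq → E.SlotDone tx.initiator r) {q : Fin N}
    (hq : q ∈ R) : ∀ᶠ k in atTop, Supported t (E.at_ k q) tx := by
  rcases hb with hb | ⟨A, hA, hAt, hb⟩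
  -- At least N - t rational agents echo, and 2(N - t) > N + t because N > 3t.
  · have := le_card_rational hR
    filter_upwards [eventually_le_count_echo h subset_rfl hb hq] with k hk
    left
    omega
  · filter_upwards [eventually_le_count_ready h hA hb hq] with k hk using .inr (hAt.trans hk)

theorem Backed.exists_echoQuorum (ht : 3 * t < N) (hR : Rᶜ.card ≤ t) {tx : Tx N}
    (hb : E.Backed tx) : ∃ n, E.EchoQuorum n tx := by
  rcases hb with hb | ⟨A, hA, hAt, hb⟩
  · have h : ∀ᶠ k in atTop, ∀ p ∈ R, tx ∈ (E.at_ k p).echoOut :=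
      (Filter.eventually_all_finset R).mpr hb
    obtain ⟨n, hn⟩ := h.exists
    refine ⟨n, ?_⟩
    have hu : {j | j ∈ R → tx ∈ (E.at_ n j).echoOut} = Set.univ :=
      Set.eq_univ_of_forall fun j hj => hn j hj
    rw [EchoQuorum, hu, Set.ncard_univ, Nat.card_eq_fintype_card, Fintype.card_fin]
    omega
  · obtain ⟨p, hp⟩ := Finset.card_pos.mp (lt_of_lt_of_le (Nat.succ_pos t) hAt)
    obtain ⟨n, hn⟩ := (hb p hp).exists
    exact ⟨n, echoQuorum_of_mem_readyOut hR hn⟩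

/-- Once the lower slots are done, support reaches every rational agent. The ready or delivered
occupant of the slot has an echo quorum, and so does `tx`, so the two are equal. The at least N - t
≥ 2t + 1 rational ready messages then suffice for delivery. -/
theorem Backed.slotDone_and_delivered (ht : 3 * t < N) (hR : Rᶜ.card ≤ t) {tx : Tx N}
    (hb : E.Backed tx) (h : ∀ r, 1 ≤ r → r < tx.seq → E.SlotDone tx.initiator r) :
    E.SlotDone tx.initiator tx.seq ∧
      ∀ q ∈ R, ∀ᶠ k in atTop, tx ∈ (E.at_ k q).delivered := by
  obtain ⟨n, hn⟩ := hb.exists_echoQuorum ht hR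
  have hready : ∀ p ∈ R, ∀ᶠ k in atTop, tx ∈ (E.at_ k p).readyOut := by
    intro p hp
    obtain ⟨u, hu, hk⟩ := eventually_queue_ready hp (hb.eventually_supported ht hR h hp)
    obtain ⟨m, hm⟩ := hk.exists
    rwa [(echoQuorum_of_mem_readyOut hR hm).agree hR hn hu] at hk
  constructor
  -- The echoed `u` may differ from `tx`; this is harmless, as retaliation only asks whether the
  -- slot is occupied.
  · intro p hp q hq
    obtain ⟨u, ⟨hui, hus⟩, hk⟩ :=
      eventually_queue_echo hp (hb.eventually_supported ht hR h hp)
    have h1 := eventually_mem_echoIn (by rwa [hui, hus]) hp hq hk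
    filter_upwards [h1, eventually_mem_readyIn h hp hq (hready p hp)] with k h1 h2
    exact ⟨⟨u, h1, hui, hus⟩, ⟨tx, h2, rfl, rfl⟩⟩
  · intro q hq
    have hc : ∀ᶠ k in atTop, 2 * t + 1 ≤ count (E.at_ k q).readyIn tx := by
      have := le_card_rational hR
      filter_upwards [eventually_le_count_ready h subset_rfl hready hq] with k hk
      omega
    obtain ⟨u, hu, hk⟩ := eventually_deliver hq hc
    obtain ⟨m, hm⟩ := hk.exists
    rwa [(echoQuorum_of_mem_delivered hR hm).agree hR hn hu] at hk

/-- If a transaction and one in each lower slot of its instance is backed, then all rational agents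
deliver it. -/
theorem Backed.eventually_delivered (ht : 3 * t < N) (hR : Rᶜ.card ≤ t) {tx : Tx N}
    (hb : E.Backed tx) (h : ∀ r, 1 ≤ r → r < tx.seq →
      ∃ u, u.initiator = tx.initiator ∧ u.seq = r ∧ E.Backed u) {q : Fin N} (hq : q ∈ R) :
    ∀ᶠ k in atTop, tx ∈ (E.at_ k q).delivered := by
  refine (hb.slotDone_and_delivered ht hR fun r => ?_).2 q hq
  induction r using Nat.strong_induction_on with
  | _ r ih =>
    intro h1 h2
    obtain ⟨u, hi, rfl, hu⟩ := h r h1 h2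
    rw [← hi] at ih ⊢
    exact (hu.slotDone_and_delivered ht hR fun r hr hr' => ih r hr' hr (hr'.trans h2)).1

theorem backed_of_mem_delivered (hR : Rᶜ.card ≤ t) {n : ℕ} {q : Fin N} {tx : Tx N}
    (h : tx ∈ (E.at_ n q).delivered) : E.Backed tx := by
  obtain ⟨A, hA, hAt, h⟩ := exists_backers_of_mem_delivered hR h
  exact .inr ⟨A, hA, hAt, fun p hp => eventually_mem (E.readyOut_mono p) (h p hp)⟩

/-- The initial message reaches every rational agent. If the echo slot is already taken, its
occupant was broadcast by the same rational initiator under the same sequence number, and is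
therefore `tx`. -/
theorem backed_of_mem_sent (ht : 3 * t < N) (hR : Rᶜ.card ≤ t) {n : ℕ} {p : Fin N} {tx : Tx N}
    (h : tx ∈ (E.at_ n p).sent) : E.Backed tx := by
  obtain ⟨m, -, hm⟩ := exists_broadcastsAt_of_mem_sent h
  obtain ⟨hp, ha, -, hnet⟩ := hm.payAllowed
  have hi : tx.initiator = p := ha.2.1
  left
  intro q hq
  obtain ⟨k, hk⟩ := E.reliable (m + 1) _ (hnet q) hp hq
  obtain ⟨u, hu, hus⟩ := exists_sameSlot_file (E.at_ k q).echoOut tx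
  have hu' : u ∈ (E.at_ (k + 1) q).echoOut := by
    have := at_succ_of_receive hk
    simp only at this
    rw [this]
    simpa [receive, hi] using hu
  have hsent := mem_sent_of_mem_echoOut ht hR hu' (by rwa [hus.1, hi])
  rw [hus.1, hi] at hsent
  have : u = tx := (E.sent_seq (max (k + 1) n) p).2.2.2 u
    (E.sent_mono p (le_max_left _ _) hsent) tx (E.sent_mono p (le_max_right _ _) h) hus.2
  subst this
  exact eventually_mem (E.echoOut_mono q) hu'

theorem eventually_delivered_of_mem_sent (ht : 3 * t < N) (hR : Rᶜ.card ≤ t) {n : ℕ}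
    {p : Fin N} {tx : Tx N} (h : tx ∈ (E.at_ n p).sent) {q : Fin N} (hq : q ∈ R) :
    ∀ᶠ k in atTop, tx ∈ (E.at_ k q).delivered := by
  obtain ⟨-, h2, h3, -⟩ := E.sent_seq n p
  refine (backed_of_mem_sent ht hR h).eventually_delivered ht hR (fun r hr hr' => ?_) hq
  obtain ⟨u, hu, hur⟩ := h3 r hr (hr'.trans (h2 tx h).2.2)
  exact ⟨u, (h2 u hu).1.trans (h2 tx h).1.symm, hur, backed_of_mem_sent ht hR hu⟩

theorem ExecutesAt.eventually_delivered (ht : 3 * t < N) (hR : Rᶜ.card ≤ t) (hε : 0 ≤ ε)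
    (hB₀ : ∀ i, N * ε < B₀ i) {n : ℕ} {p q : Fin N} {tx : Tx N} (h : E.ExecutesAt n p tx)
    (hq : q ∈ R) : ∀ᶠ k in atTop, tx ∈ (E.at_ k q).delivered := by
  have hm := h.mayExecute.1
  refine (backed_of_mem_delivered hR hm.1).eventually_delivered ht hR (fun r hr hr' => ?_) hq
  have hS := hm.2.1
  obtain ⟨u, hu, hui, hur⟩ :=
    (accountsInv hε hB₀ E n p).filled tx.initiator r hr (by omega)
  exact ⟨u, hui, hur, backed_of_mem_delivered hR (mem_delivered_of_mem_executed hu)⟩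

/-! ### Totality of execution -/

/-- A delivered transaction is eventually executed if everything it refers to and all earlier
transactions of its initiator are, and the third condition for its execution holds whenever its
turn has come. -/
theorem eventually_executed (hR : Rᶜ.card ≤ t) (hε : 0 ≤ ε) (hB₀ : ∀ i, N * ε < B₀ i)
    {q : Fin N} (hq : q ∈ R) {tx : Tx N} (h1 : 1 ≤ tx.seq)
    (hd : ∀ᶠ k in atTop, tx ∈ (E.at_ k q).delivered)
    (hr : ∀ u, u ∈ tx.deps ∨ u ∈ tx.fees → ∀ᶠ k in atTop, u ∈ (E.at_ k q).executed)
    (hs : ∀ᶠ k in atTop, tx.seq ≤ (E.at_ k q).S tx.initiator + 1)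
    (hB : ∀ᶠ k in atTop, tx ∉ (E.at_ k q).executed →
      (∀ u, u ∈ tx.deps ∨ u ∈ tx.fees → u ∈ (E.at_ k q).executed) →
      (E.at_ k q).S tx.initiator + 1 = tx.seq →
      N * ε ≤ (E.at_ k q).B tx.initiator ∨ N ≤ (creditedFees (E.at_ k q) tx).card) :
    ∀ᶠ k in atTop, tx ∈ (E.at_ k q).executed := by
  have hr' : ∀ᶠ k in atTop, ∀ u ∈ (tx.deps ++ tx.fees).toFinset, u ∈ (E.at_ k q).executed := by
    rw [Filter.eventually_all_finset]
    intro u hu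
    exact hr u (by simpa using hu)
  refine eventually_of_fair (E := E) hq (.execute tx)
    (fun n hn => E.executed_mono q n.le_succ hn) ?_ ?_
  · filter_upwards [hd, hr', hs, hB] with k k1 k2 k3 k4 k5
    have k2' : ∀ u, u ∈ tx.deps ∨ u ∈ tx.fees → u ∈ (E.at_ k q).executed :=
      fun u hu => k2 u (by simpa using hu)
    -- If the counter had passed the slot of `tx`, an executed transaction would occupy it, and by
    -- agreement that would be `tx`.
    have k6 : (E.at_ k q).S tx.initiator + 1 = tx.seq := by
      by_contra hne
      obtain ⟨u, hu, hui, hus⟩ :=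
        (accountsInv hε hB₀ E k q).filled tx.initiator tx.seq h1 (by omega)
      have : u = tx := (echoQuorum_of_mem_delivered hR (mem_delivered_of_mem_executed hu)).agree hR
        (echoQuorum_of_mem_delivered hR k1) ⟨hui, hus⟩
      exact k5 (this ▸ hu)
    exact ⟨k1, k6, k2', k4 k5 k2' k6⟩
  · exact fun k hk => ExecutesAt.mem_executed hk k.lt_succ_self

theorem eventually_seq_le (hε : 0 ≤ ε) (hB₀ : ∀ i, N * ε < B₀ i) {q : Fin N} {tx u : Tx N}
    (hu : ∀ᶠ k in atTop, u ∈ (E.at_ k q).executed) (hi : u.initiator = tx.initiator)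
    (hs : u.seq + 1 = tx.seq) : ∀ᶠ k in atTop, tx.seq ≤ (E.at_ k q).S tx.initiator + 1 := by
  filter_upwards [hu] with k hk
  have := ((accountsInv hε hB₀ E k q).seq u hk).2
  rw [hi] at this
  omega

/-- What one agent has executed, all rational agents eventually execute. -/
theorem ExecutesAt.eventually_executed (ht : 3 * t < N) (hR : Rᶜ.card ≤ t) (hε : 0 ≤ ε)
    (hB₀ : ∀ i, N * ε < B₀ i) {n : ℕ} {p q : Fin N} {tx : Tx N} (h : E.ExecutesAt n p tx)
    (hq : q ∈ R) : ∀ᶠ k in atTop, tx ∈ (E.at_ k q).executed := by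
  induction n using Nat.strong_induction_on generalizing tx with
  | _ n ih =>
    have hI := accountsInv hε hB₀ E n p
    have hex : ∀ u ∈ (E.at_ n p).executed, ∀ᶠ k in atTop, u ∈ (E.at_ k q).executed := by
      intro u hu
      obtain ⟨m, hm, hum⟩ := exists_executesAt_of_mem_executed hu
      exact ih m hm hum
    obtain ⟨hd, hs, hr, hB⟩ := h.mayExecute.1
    refine Execution.eventually_executed hR hε hB₀ hq (by omega)
      (h.eventually_delivered ht hR hε hB₀ hq) (fun u hu => hex u (hr u hu)) ?_ ?_
    · by_cases h1 : tx.seq = 1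
      · exact .of_forall fun k => by omega
      · obtain ⟨u, hu, hui, hus⟩ := hI.filled tx.initiator (tx.seq - 1) (by omega) (by omega)
        exact eventually_seq_le hε hB₀ (hex u hu) hui (by omega)
    -- At the turn of `tx`, agent `q` sees the same balance and the same fee credits as `p` did at
    -- time `n`, so condition (3) carries over.
    · refine .of_forall fun k _ hr' hs' => ?_
      obtain ⟨-, hF, hBB, -⟩ := hI.execute_congr (accountsInv hε hB₀ E k q)
        (executedAgree hR E n k p q) (badAgree hR hε hB₀ E n k p q) (by omega) hr hr'
      rwa [← hF, ← hBB]

/-! ### Transactions of rational agents -/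

/-- Pay refers only to entries of `Q` and `F` in the initiator's own view, so condition (2) never
delays the initiator. -/
theorem refs_of_mem_sent (hε : 0 ≤ ε) (hB₀ : ∀ i, N * ε < B₀ i) {n : ℕ} {p : Fin N}
    {tx u : Tx N} (h : tx ∈ (E.at_ n p).sent) (hu : u ∈ tx.deps ∨ u ∈ tx.fees) :
    u ∈ (E.at_ n p).executed := by
  obtain ⟨m, hm, hb⟩ := exists_broadcastsAt_of_mem_sent h
  obtain ⟨-, ⟨-, -, -, hd, hf⟩, -⟩ := hb.payAllowed
  have hI := accountsInv hε hB₀ E m p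
  refine E.executed_mono p hm.le ?_
  rcases hu with hu | hu
  · exact ((hI.mem_Q p u).mp ((hd u).mp hu).1).1
  · rcases hf with hf | hf
    · simp [hf] at hu
    · exact ((hI.mem_F p u).mp ((hf u).mp hu).1).1

/-- The balance of a rational agent covers the transactions it has broadcast up to `tx` but not
yet executed. -/
theorem sum_unexecuted_le (ht : 3 * t < N) (hR : Rᶜ.card ≤ t) (hε : 0 ≤ ε)
    (hB₀ : ∀ i, N * ε < B₀ i) {p : Fin N} {tx : Tx N} {n : ℕ} (h : E.BroadcastsAt n p tx)
    (hB : outstanding ε (E.at_ (n + 1) p) ≤ (E.at_ n p).B p) {m : ℕ} (hnm : n + 1 ≤ m)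
    (htx : tx ∉ (E.at_ m p).executed) :
    ∑ u ∈ (E.at_ (n + 1) p).sent \ (E.at_ m p).executed, ((u.value : ℝ) + N * ε) ≤
      (E.at_ m p).B p := by
  obtain ⟨hp, ha, hpay, -⟩ := h.payAllowed
  induction m, hnm using Nat.le_induction with
  | base =>
    refine hB.trans (le_of_eq ?_)
    rw [hpay]
    rfl
  | succ m hnm ih =>
    have ih := ih fun h => htx (E.executed_mono p m.le_succ h)
    rcases (E.step m).accounts p with h' | ⟨v, he, hm, h'⟩
    · rw [show E.at_ (m + 1) p = (E.conf (m + 1)).loc p from rfl, h'.executed, h'.B]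
      exact ih
    · have he' : E.ExecutesAt m p v := he
      have hI := accountsInv hε hB₀ E m p
      have hve := hI.notMem_executed hm
      rw [show E.at_ (m + 1) p = (E.conf (m + 1)).loc p from rfl, h'] at htx ⊢
      by_cases hv : v.initiator = p
      -- Credits only raise the balance, so executing `v` lowers it by at most the summand of `v`,
      -- which leaves the sum at the same time.
      · have hB' : (E.at_ m p).B p ≤ (Hearsay.execute ε (E.at_ m p) v).B p
            + ((v.value : ℝ) + N * ε) := by
          subst hv
          have h1 : (E.at_ m v.initiator).B v.initiator ≤ available ε (E.at_ m v.initiator) v :=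
            le_available hε
          have h2 : (0 : ℝ) ≤ v.value := v.value.2
          simp only [Hearsay.execute, Function.update_self]
          split_ifs <;> linarith
        have hvs : v ∈ (E.at_ (n + 1) p).sent := by
          obtain ⟨k, hk, hb⟩ := he'.exists_broadcastsAt ht hR (hv ▸ hp)
          rw [hv] at hb
          have hvm : v ∈ (E.at_ m p).sent := E.sent_mono p (Nat.succ_le_of_lt hk) hb.mem_sent
          -- Otherwise the slot of `tx` would be filled already, by a transaction that `p` has
          -- broadcast itself, hence by `tx`. So later broadcasts cannot consume the reserved
          -- balance.
          have hseq : v.seq ≤ tx.seq := by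
            by_contra! hlt
            have h2 := hm.2.1
            obtain ⟨w, hw, hwi, hws⟩ := hI.filled p tx.seq
              ((E.sent_seq (n + 1) p).2.1 tx h.mem_sent).2.1 (by
                change (E.at_ m p).S v.initiator + 1 = v.seq at h2
                rw [hv] at h2
                omega)
            obtain ⟨k', hk', hwk⟩ := exists_executesAt_of_mem_executed hw
            obtain ⟨k'', hk'', hb'⟩ := hwk.exists_broadcastsAt ht hR (hwi ▸ hp)
            rw [hwi] at hb'
            have hwt : w = tx := (E.sent_seq m p).2.2.2 w
              (E.sent_mono p (by omega) hb'.mem_sent) tx (E.sent_mono p hnm h.mem_sent) hws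
            subst hwt
            exact htx (mem_execute_executed.mpr (.inr hw))
          obtain ⟨-, k2, k3, -⟩ := E.sent_seq (n + 1) p
          obtain ⟨w, hw, hws⟩ := k3 v.seq ((E.sent_seq m p).2.1 v hvm).2.1
            (lt_of_le_of_lt hseq (k2 tx h.mem_sent).2.2)
          rwa [← (E.sent_seq m p).2.2.2 w (E.sent_mono p hnm hw) v hvm hws]
        have hsd : (E.at_ (n + 1) p).sent \ (Hearsay.execute ε (E.at_ m p) v).executed =
            ((E.at_ (n + 1) p).sent \ (E.at_ m p).executed).erase v := by
          ext u
          simp only [Finset.mem_sdiff, mem_execute_executed, Finset.mem_erase]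
          tauto
        change ∑ u ∈ (E.at_ (n + 1) p).sent \ (Hearsay.execute ε (E.at_ m p) v).executed,
          ((u.value : ℝ) + N * ε) ≤ (Hearsay.execute ε (E.at_ m p) v).B p
        rw [hsd]
        have := Finset.add_sum_erase ((E.at_ (n + 1) p).sent \ (E.at_ m p).executed)
          (fun u => (u.value : ℝ) + N * ε) (Finset.mem_sdiff.mpr ⟨hvs, hve⟩)
        linarith
      · have hBe : (Hearsay.execute ε ((E.conf m).loc p) v).B p = (E.at_ m p).B p := by
          simp [Hearsay.execute, Ne.symm hv, at_]
        rw [hBe]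
        refine le_trans (Finset.sum_le_sum_of_subset_of_nonneg ?_ ?_) ih
        · intro u hu
          rw [Finset.mem_sdiff, mem_execute_executed] at hu
          exact Finset.mem_sdiff.mpr ⟨hu.1, fun h => hu.2 (.inr h)⟩
        · intro u _ _
          have := u.value.2
          positivity

/-- A covered transaction of a rational agent is eventually executed by its initiator. -/
theorem BroadcastsAt.eventually_executed_self (ht : 3 * t < N) (hR : Rᶜ.card ≤ t) (hε : 0 ≤ ε)
    (hB₀ : ∀ i, N * ε < B₀ i) {p : Fin N} {tx : Tx N} {n : ℕ} (h : E.BroadcastsAt n p tx)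
    (hB : outstanding ε (E.at_ (n + 1) p) ≤ (E.at_ n p).B p) :
    ∀ᶠ k in atTop, tx ∈ (E.at_ k p).executed := by
  obtain ⟨hp, ha, hpay, -⟩ := h.payAllowed
  obtain ⟨-, h2, h3, -⟩ := E.sent_seq (n + 1) p
  by_contra hcon
  -- Arguing by contradiction makes `sum_unexecuted_le` available at all later times. It secures the
  -- fees of each predecessor in turn, up to `tx`.
  have htx : ∀ k, tx ∉ (E.at_ k p).executed := fun k hk =>
    hcon (eventually_atTop.mpr ⟨k, fun _ hm => E.executed_mono p hm hk⟩)
  suffices ∀ r, ∀ v ∈ (E.at_ (n + 1) p).sent, v.seq = r →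
      ∀ᶠ k in atTop, v ∈ (E.at_ k p).executed from hcon (this _ tx h.mem_sent rfl)
  intro r
  induction r with
  | zero =>
    intro v hv hvr
    have := (h2 v hv).2.1
    omega
  | succ r ih =>
    intro v hv hvr
    refine eventually_executed hR hε hB₀ hp (h2 v hv).2.1
      (eventually_delivered_of_mem_sent ht hR hv hp)
      (fun u hu => eventually_atTop.mpr ⟨n + 1, fun k hk =>
        E.executed_mono p hk (refs_of_mem_sent hε hB₀ hv hu)⟩) ?_ ?_
    · by_cases hr : r = 0
      · exact .of_forall fun k => by omega
      · obtain ⟨u, hu, hur⟩ := h3 r (by omega) (by have := (h2 v hv).2.2; omega)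
        exact eventually_seq_le hε hB₀ (ih u hu hur) ((h2 u hu).1.trans (h2 v hv).1.symm)
          (by omega)
    · filter_upwards [eventually_ge_atTop (n + 1)] with k hk hve _ _
      left
      rw [(h2 v hv).1]
      refine le_trans ?_ (sum_unexecuted_le ht hR hε hB₀ h hB hk (htx k))
      have hv0 : (0 : ℝ) ≤ v.value := v.value.2
      refine le_trans (by linarith : (N : ℝ) * ε ≤ (v.value : ℝ) + N * ε)
        (Finset.single_le_sum (f := fun u : Tx N => (u.value : ℝ) + N * ε) (fun u _ => ?_)
          (Finset.mem_sdiff.mpr ⟨hv, hve⟩))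
      have := u.value.2
      positivity

/-- A covered transaction of a rational agent is eventually executed by all rational agents. -/
theorem BroadcastsAt.exists_executesAt (ht : 3 * t < N) (hR : Rᶜ.card ≤ t) (hε : 0 ≤ ε)
    (hB₀ : ∀ i, N * ε < B₀ i) {p : Fin N} {tx : Tx N} {n : ℕ} (h : E.BroadcastsAt n p tx)
    (hB : outstanding ε (E.at_ (n + 1) p) ≤ (E.at_ n p).B p) {q : Fin N} (hq : q ∈ R) :
    ∃ m, n < m ∧ E.ExecutesAt m q tx := by
  obtain ⟨hp, ha, hpay, -⟩ := h.payAllowed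
  obtain ⟨k, hk⟩ := (h.eventually_executed_self ht hR hε hB₀ hB).exists
  obtain ⟨k', -, hk'⟩ := exists_executesAt_of_mem_executed hk
  obtain ⟨l, hl⟩ := (hk'.eventually_executed ht hR hε hB₀ hq).exists
  obtain ⟨m, -, hm⟩ := exists_executesAt_of_mem_executed hl
  refine ⟨m, ?_, hm⟩
  have hi : tx.initiator = p := ha.2.1
  -- An execution at or before time `n` would require a broadcast of `tx` before `n`; its sequence
  -- number would then be below the counter at `n`, which it equals.
  obtain ⟨n', hn', hb⟩ := hm.exists_broadcastsAt ht hR (hi ▸ hp)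
  rw [hi] at hb
  by_contra! hmn
  have h1 := ((E.sent_seq n p).2.1 tx
    (E.sent_mono p (by omega : n' + 1 ≤ n) hb.mem_sent)).2.2
  have h2 : tx.seq = (E.at_ n p).ctr := ha.2.2.1
  omega

end Execution

end Hearsay

theorem mainTheorem5 (N t : ℕ) (ht : 3 * t < N) (ε : ℝ) (hε : 0 ≤ ε)
    (B₀ : Fin N → ℝ) (hB₀ : ∀ i, N * ε < B₀ i)
    (R : Finset (Fin N)) (hR : Rᶜ.card ≤ t)
    (E : Hearsay.Execution N t ε B₀ R) :
    -- a transaction broadcast by a rational agent is eventually executed by all rational agents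
    (∀ p ∈ R, ∀ tx n, E.BroadcastsAt n p tx →
      Hearsay.outstanding ε (E.at_ (n + 1) p) ≤ (E.at_ n p).B p →
      ∀ q ∈ R, ∃ m, n < m ∧ E.ExecutesAt m q tx) ∧
    -- no agent enters into debt
    (∀ q ∈ R, ∀ n i, 0 ≤ (E.at_ n q).B i) ∧
    -- no agent spends money it does not have: fees and payments are covered
    (∀ q ∈ R, ∀ n tx, E.ExecutesAt n q tx → N * ε ≤ Hearsay.available ε (E.at_ n q) tx) ∧
    (∀ q ∈ R, ∀ n tx, E.CommitsAt n q tx →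
      tx.value + N * ε ≤ Hearsay.available ε (E.at_ n q) tx) ∧
    -- a transaction rejected by one rational agent is committed by none
    (∀ q ∈ R, ∀ q' ∈ R, ∀ n n' tx, E.ExecutesAt n q tx → ¬ E.CommitsAt n q tx →
      ¬ E.CommitsAt n' q' tx) ∧
    -- the money of a rational agent is spent only by transactions it has broadcast itself
    (∀ q ∈ R, ∀ n tx, E.ExecutesAt n q tx → tx.initiator ∈ R →
      ∃ m, m < n ∧ E.BroadcastsAt m tx.initiator tx) ∧
    -- no double spending: rational agents do not execute conflicting transactions,
    (∀ q ∈ R, ∀ q' ∈ R, ∀ n n' tx tx', E.ExecutesAt n q tx → E.ExecutesAt n' q' tx' →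
      tx.initiator = tx'.initiator → tx.seq = tx'.seq → tx = tx') ∧
    -- no rational agent executes a transaction twice,
    (∀ q ∈ R, ∀ n n' tx, E.ExecutesAt n q tx → E.ExecutesAt n' q tx → n = n') ∧
    -- no payment and no fee credit is used by two transactions,
    (∀ q ∈ R, ∀ q' ∈ R, ∀ n n' tx tx' u, E.ExecutesAt n q tx → E.ExecutesAt n' q' tx' →
      u ∈ Hearsay.creditedDeps (E.at_ n q) tx → u ∈ Hearsay.creditedDeps (E.at_ n' q') tx' →
      tx = tx') ∧
    (∀ q ∈ R, ∀ q' ∈ R, ∀ n n' tx tx' u, E.ExecutesAt n q tx → E.ExecutesAt n' q' tx' →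
      tx.initiator = tx'.initiator →
      u ∈ Hearsay.creditedFees (E.at_ n q) tx → u ∈ Hearsay.creditedFees (E.at_ n' q') tx' →
      tx = tx') ∧
    -- and the money of each agent is exactly what it had and received minus what it spent
    (∀ q ∈ R, ∀ n i,
      (E.at_ n q).B i + ∑ u ∈ (E.at_ n q).Q i, (u.value : ℝ) + ((E.at_ n q).F i).card * ε =
        B₀ i + ∑ u ∈ (E.at_ n q).committed with u.recipient = i, (u.value : ℝ)
          + (E.at_ n q).executed.card * ε
          - ∑ u ∈ (E.at_ n q).committed with u.initiator = i, (u.value : ℝ)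
          - ((E.at_ n q).executed.filter (fun u => u.initiator = i)).card * (N * ε)) := by
  have hI := E.accountsInv hε hB₀
  refine ⟨fun p _ tx n h hB q hq => h.exists_executesAt ht hR hε hB₀ hB hq,
    fun q _ n i => (hI n q).nonneg i,
    fun q _ n tx h => (hI n q).fees_le_available hε h.mayExecute.1,
    fun q _ n tx h => not_lt.mp fun hlt => h.2 (.inl hlt),
    fun q _ q' _ n n' tx h hc hc' =>
      hc ⟨h, fun hb => hc'.2 ((h.isBad_iff hR hε hB₀ hc'.1).mp hb)⟩,
    fun q _ n tx h htx => h.exists_broadcastsAt ht hR htx,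
    fun q _ q' _ n n' tx tx' h h' hi hs => h.eq_of_sameSlot hR h' ⟨hi, hs⟩,
    fun q _ n n' tx h h' => le_antisymm (not_lt.mp (h'.not_lt hε hB₀ h))
      (not_lt.mp (h.not_lt hε hB₀ h')),
    fun q _ q' _ n n' tx tx' u h h' hu hu' =>
      Hearsay.Execution.eq_of_mem_creditedDeps hR hε hB₀ h h' hu hu',
    fun q _ q' _ n n' tx tx' u h h' hi hu hu' =>
      Hearsay.Execution.eq_of_mem_creditedFees hR hε hB₀ h h' hi hu hu',
    fun q _ n i => (hI n q).total i⟩
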